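/- Let $\tau\in\mathbb C$ with $\operatorname{Im}\tau>0$, $\Lambda=\mathbb Z+\tau\mathbb Z$, $q=e^{\pi i\tau}$, and let $$\theta(z)=2q^{1/4}\sum_{m\ge 0}(-1)^m q^{m(m+1)}\sin((2m+1)\pi z)\quad (q^{1/4}=e^{\pi i\tau/4}),\qquad \bar\theta(z)=\sum_{m\in\mathbb Z}e^{\pi i m^2\tau+2\pi i m z},\qquad \sigma(u,x)=\frac{\theta'(0)\,\theta(u+x)}{\theta(u)\,\theta(x)}$$ be the first and third Jacobi theta functions and the Kronecker function. For an invertible matrix $B\in\mathrm{Mat}_{n\times n}(\mathbb C)$ and $v,y_1\in\mathbb C$ let $\mathsf{Sol}_{B,v,y_1}$ be the complex vector space of holomorphic $\Phi:\mathbb C\to \mathrm{Mat}_{n\times n}(\mathbb C)$ with $$\Phi(z+1)=\Phi(z),\qquad \Phi(z+\tau)B=-e^{-2\pi i(z+v-y_1+\tau)}\,B\,\Phi(z).$$ Put $\mathrm{res}_{y_1}(\Phi)=\Phi(y_1)$ and, for $y_2-y_1\notin\Lambda$, $\mathrm{ev}_{y_2}(\Phi)=\Phi(y_2)/\bar\theta\bigl(y_2-y_1+\tfrac{\tau+1}{2}\bigr)$.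 Whenever $v=v_1-v_2$ is such that $\mathrm{res}_{y_1}$ is an isomorphism, let $r_B(v_1,v_2;y_1,y_2)\in \mathrm{Mat}_{n\times n}(\mathbb C)\otimes \mathrm{Mat}_{n\times n}(\mathbb C)$ be the tensor corresponding to the linear map $\mathrm{ev}_{y_2}\circ\mathrm{res}_{y_1}^{-1}$ under the canonical isomorphism that sends $X\otimes Y$ to the map $Z\mapsto \mathrm{Tr}(XZ)\,Y$. For $n\ge1$ let $J=J_n(1)$ be the Jordan block of size $n$ with eigenvalue $1$ (ones on the superdiagonal). Put $a_k=(-1)^k/k$ for $1\le k\le n-1$; let $A_0$ be the strictly lower triangular $n\times n$ Toeplitz matrix with $a_k$ on the $k$-th subdiagonal, let $A_k=-a_k\mathbb 1_{n\times n}$ for $1\le k\le n-1$, and let $N\in\mathrm{Mat}_{n^2\times n^2}(\mathbb C)$ be the block upper triangular block Toeplitz matrix with first block row $(A_0,A_1,\dots,A_{n-1})$. For $0\le k,l\le n-1$ let $$\nabla_{k,l}=e_{n(n-k-1)+l+1}^{\,t}\,\exp(\nabla N)\,e_{n(n-1)+1},\qquad \nabla=-\frac1{2\pi i}\frac{\partial}{\partial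 v},$$ a polynomial in $\nabla$ because $N$ is nilpotent. **Theorem.** 1. $\theta'(0)\ne0$, and $\theta(z)\neq0$ and $\bar\theta(z+\frac{\tau+1}2)\ne0$ for all $z\notin\Lambda$; moreover $N^{2n-1}=0$. 2. Let $n\ge1$ and $v_1,v_2,y_1,y_2\in\mathbb C$ with $v=v_1-v_2\notin\Lambda$ and $y=y_2-y_1\notin\Lambda$. Then $\mathrm{res}_{y_1}:\mathsf{Sol}_{J,v,y_1}\to\mathrm{Mat}_{n\times n}(\mathbb C)$ is an isomorphism, and $$r_J(v_1,v_2;y_1,y_2)=\frac{e^{\pi i\tau/4}}{i\,\theta'(0)}\sum_{0\le k,l\le n-1}\nabla_{k,l}\bigl(\sigma(v,y)\bigr)\sum_{\substack{1\le i\le n-l\\ 1\le j\le n-k}}e_{i,j+k}\otimes e_{j,i+l},$$ where $\nabla_{k,l}$ acts on the first variable of $\sigma$. 3. For $n=2$, with $h=e_{11}-e_{22}$ and $\sigma',\sigma''$ the derivatives of $\sigma$ in its first variable, this reads $$r_J(v_1,v_2;y_1,y_2)=\frac{e^{\pi i\tau/4}}{i\,\theta'(0)}\Bigl[\sigma(v,y)\bigl(e_{11}\otimes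 e_{11}+e_{22}\otimes e_{22}+e_{12}\otimes e_{21}+e_{21}\otimes e_{12}\bigr)-\tfrac1{2\pi i}\sigma'(v,y)\bigl(e_{12}\otimes h-h\otimes e_{12}\bigr)-\tfrac1{(2\pi i)^2}\sigma''(v,y)\,e_{12}\otimes e_{12}\Bigr].$$ -/

import Mathlib

open scoped TensorProduct Polynomial

namespace JordanAYBE

/-- The algebra of `n × n` complex matrices. -/
abbrev Mat (n : ℕ) : Type := Matrix (Fin n) (Fin n) ℂ

/-- The elementary matrix `e_{a,b}`, with rows and columns numbered from `1` to `n`. -/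
def e (n a b : ℕ) : Mat n :=
  Matrix.of fun p q => if (p : ℕ) + 1 = a ∧ (q : ℕ) + 1 = b then 1 else 0

/-- The Jordan block `J_n(1)`, with ones on the diagonal and on the first superdiagonal. -/
def jordan (n : ℕ) : Mat n :=
  Matrix.of fun p q => if p = q ∨ (p : ℕ) + 1 = (q : ℕ) then 1 else 0

/-- The lattice `Λ = ℤ + τ ℤ`. -/
def lattice (τ : ℂ) : Set ℂ := {z | ∃ a b : ℤ, z = a + b * τ}

/-! ### Theta functions and the Kronecker function -/

/-- The first Jacobian theta function
`θ(z) = 2 q^{1/4} ∑_{m ≥ 0} (-1)^m q^{m(m+1)} sin((2m+1)πz)`, where `q = exp(πiτ)`. -/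
noncomputable def theta (τ z : ℂ) : ℂ :=
  2 * Complex.exp (Real.pi * Complex.I * τ / 4) *
    ∑' m : ℕ, (-1) ^ m * Complex.exp (Real.pi * Complex.I * τ) ^ (m * (m + 1)) *
      Complex.sin ((2 * m + 1) * Real.pi * z)

/-- The third Jacobian theta function `∑_{m ∈ ℤ} exp(πi m² τ + 2πi m z)`. -/
noncomputable def thetaBar (τ z : ℂ) : ℂ := jacobiTheta₂ z τ

/-- The Kronecker function `σ(u, x) = θ'(0) θ(u + x) / (θ(u) θ(x))`. -/
noncomputable def sigma (τ u x : ℂ) : ℂ :=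
  deriv (theta τ) 0 * theta τ (u + x) / (theta τ u * theta τ x)

/-! ### The solution attached to a matrix -/

/-- The factor `e(z) = e(z, v, y, τ) = -exp(-2πi(z + v - y + τ))`. -/
noncomputable def factor (τ v y z : ℂ) : ℂ :=
  -Complex.exp (-2 * Real.pi * Complex.I * (z + v - y + τ))

/-- The space of holomorphic `Φ : ℂ → Mat_{n×n}(ℂ)` with `Φ(z+1) = Φ(z)` and
`Φ(z+τ) B = e(z, v, y, τ) B Φ(z)`. -/
def Sol {n : ℕ} (B : Mat n) (τ v y : ℂ) : Submodule ℂ (ℂ → Mat n) where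
  carrier := {Φ | (∀ i j, Differentiable ℂ fun z => Φ z i j) ∧
    (∀ z, Φ (z + 1) = Φ z) ∧ (∀ z, Φ (z + τ) * B = factor τ v y z • (B * Φ z))}
  add_mem' := by
    rintro Φ Ψ ⟨h1, h2, h3⟩ ⟨k1, k2, k3⟩
    refine ⟨fun i j => (h1 i j).add (k1 i j), fun z => ?_, fun z => ?_⟩
    · simp only [Pi.add_apply, h2, k2]
    · simp only [Pi.add_apply, add_mul, mul_add, h3, k3, smul_add]
  zero_mem' := by
    refine ⟨fun i j => differentiable_const 0, fun z => rfl, fun z => ?_⟩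
    simp only [Pi.zero_apply, zero_mul, mul_zero, smul_zero]
  smul_mem' := by
    rintro c Φ ⟨h1, h2, h3⟩
    refine ⟨fun i j => (h1 i j).const_mul c, fun z => ?_, fun z => ?_⟩
    · simp only [Pi.smul_apply, h2]
    · simp only [Pi.smul_apply, Matrix.smul_mul, Matrix.mul_smul, h3]
      rw [smul_comm]

/-- The residue map `Φ ↦ Φ(y₁)` on `Sol_{B, v, y₁, τ}`. -/
def res {n : ℕ} (B : Mat n) (τ v y₁ : ℂ) : Sol B τ v y₁ →ₗ[ℂ] Mat n :=
  LinearMap.proj y₁ ∘ₗ (Sol B τ v y₁).subtype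

/-- The evaluation map `Φ ↦ Φ(y₂) / θ̄(y₂ - y₁ + (τ+1)/2)` on `Sol_{B, v, y₁, τ}`. -/
noncomputable def ev {n : ℕ} (B : Mat n) (τ v y₁ y₂ : ℂ) : Sol B τ v y₁ →ₗ[ℂ] Mat n :=
  (1 / thetaBar τ (y₂ - y₁ + (τ + 1) / 2)) •
    (LinearMap.proj y₂ ∘ₗ (Sol B τ v y₁).subtype)

open Classical in
/-- The linear map `r̃_B(v₁, v₂; y₁, y₂) = ev_{y₂} ∘ res_{y₁}⁻¹` on `Mat_{n×n}(ℂ)`, with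
`v = v₁ - v₂`. It is given the value `0` where `res_{y₁}` is not an isomorphism. -/
noncomputable def rTilde {n : ℕ} (B : Mat n) (τ v₁ v₂ y₁ y₂ : ℂ) : Mat n →ₗ[ℂ] Mat n :=
  if h : Function.Bijective (res B τ (v₁ - v₂) y₁) then
    ev B τ (v₁ - v₂) y₁ y₂ ∘ₗ
      ((LinearEquiv.ofBijective (res B τ (v₁ - v₂) y₁) h).symm : Mat n →ₗ[ℂ] Sol B τ (v₁ - v₂) y₁)
  else 0

/-- The canonical map sending `X ⊗ Y` to `Z ↦ Tr(XZ) Y`. -/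
noncomputable def can (n : ℕ) : Mat n ⊗[ℂ] Mat n →ₗ[ℂ] (Mat n →ₗ[ℂ] Mat n) :=
  TensorProduct.lift <| LinearMap.mk₂ ℂ
    (fun X Y => ((Matrix.traceLinearMap (Fin n) ℂ ℂ) ∘ₗ LinearMap.mulLeft ℂ X).smulRight Y)
    (fun X X' Y => by ext1 Z; simp [add_mul, add_smul])
    (fun c X Y => by ext1 Z; simp [mul_smul])
    (fun X Y Y' => by ext1 Z; simp)
    (fun c X Y => by ext1 Z; simp [smul_comm c])

theorem can_tmul {n : ℕ} (X Y Z : Mat n) : can n (X ⊗ₜ Y) Z = (X * Z).trace • Y := by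
  simp [can]

/-- The inverse of `can`. -/
noncomputable def canInv (n : ℕ) : (Mat n →ₗ[ℂ] Mat n) →ₗ[ℂ] Mat n ⊗[ℂ] Mat n :=
  ∑ a : Fin n, ∑ b : Fin n,
    (TensorProduct.mk ℂ (Mat n) (Mat n) (Matrix.single b a 1)) ∘ₗ
      LinearMap.applyₗ (Matrix.single a b 1)

theorem canInv_apply {n : ℕ} (f : Mat n →ₗ[ℂ] Mat n) :
    canInv n f = ∑ a : Fin n, ∑ b : Fin n,
      Matrix.single b a (1 : ℂ) ⊗ₜ f (Matrix.single a b 1) := by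
  simp [canInv]

/-- The canonical isomorphism sending `X ⊗ Y` to `Z ↦ Tr(XZ) Y`. -/
noncomputable def canEquiv (n : ℕ) : (Mat n ⊗[ℂ] Mat n) ≃ₗ[ℂ] (Mat n →ₗ[ℂ] Mat n) :=
  LinearEquiv.ofLinearMap (can n) (canInv n)
    (by
      ext1 f
      ext1 Z
      conv_rhs => rw [LinearMap.id_apply, Matrix.matrix_eq_sum_single Z]
      simp only [LinearMap.comp_apply, canInv_apply, map_sum, LinearMap.sum_apply, can_tmul]
      refine Finset.sum_congr rfl fun a _ => Finset.sum_congr rfl fun b _ => ?_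
      rw [Matrix.trace_single_mul, one_smul, ← map_smul, Matrix.smul_single, smul_eq_mul, mul_one])
    (by
      refine TensorProduct.ext' fun X Y => ?_
      conv_rhs => rw [LinearMap.id_apply, Matrix.matrix_eq_sum_single X, Finset.sum_comm]
      simp only [LinearMap.comp_apply, canInv_apply, can_tmul, TensorProduct.sum_tmul,
        Matrix.trace_mul_single, TensorProduct.tmul_smul]
      refine Finset.sum_congr rfl fun a _ => Finset.sum_congr rfl fun b _ => ?_
      rw [TensorProduct.smul_tmul', Matrix.smul_single, smul_eq_mul]
      simp)

/-- The tensor `r_B(v₁, v₂; y₁, y₂)` that corresponds to `r̃_B(v₁, v₂; y₁, y₂)` under the canonical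
isomorphism. -/
noncomputable def rTensor {n : ℕ} (B : Mat n) (τ v₁ v₂ y₁ y₂ : ℂ) : Mat n ⊗[ℂ] Mat n :=
  (canEquiv n).symm (rTilde B τ v₁ v₂ y₁ y₂)

/-! ### The nilpotent matrix `N` and the operators `∇_{k,l}` -/

/-- The numbers `a_k = (-1)^k / k`, for `k ≥ 1`. -/
noncomputable def coeffA (k : ℕ) : ℂ := (-1) ^ k / k

/-- The strictly lower triangular Toeplitz matrix `A_0` with `a_k` on the `k`-th subdiagonal. -/
noncomputable def blockA0 (n : ℕ) : Mat n :=
  Matrix.of fun p q => if q < p then coeffA ((p : ℕ) - (q : ℕ)) else 0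

/-- The matrix `A_k = -a_k 𝟙`, for `k ≥ 1`. -/
noncomputable def blockA (n k : ℕ) : Mat n := (-coeffA k) • (1 : Mat n)

/-- The `n² × n²` matrix `N`, block upper triangular and block Toeplitz with first block row
`A_0, A_1, …, A_{n-1}`. The index `(α, p)` is the `p`-th index of the `α`-th block, so that the
pair `(α, p)`, counted from `0`, has position `n α + p + 1` among `1, …, n²`. -/
noncomputable def matN (n : ℕ) : Matrix (Fin n × Fin n) (Fin n × Fin n) ℂ :=
  Matrix.of fun x y =>
    if x.1 = y.1 then blockA0 n x.2 y.2
    else if x.1 < y.1 then blockA n ((y.1 : ℕ) - (x.1 : ℕ)) x.2 y.2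
    else 0

/-- `exp(∇ N)`, as a matrix whose entries are polynomials in the variable `∇`; here `exp` is the
(finite) exponential series of a nilpotent element. -/
noncomputable def expN (n : ℕ) : Matrix (Fin n × Fin n) (Fin n × Fin n) ℂ[X] :=
  IsNilpotent.exp ((Polynomial.X : ℂ[X]) • (matN n).map Polynomial.C)

/-- The polynomial `e_{n(n-k-1)+l+1}ᵗ exp(∇ N) e_{n(n-1)+1}` in `∇`, for `0 ≤ k, l ≤ n - 1`. -/
noncomputable def nablaPoly {n : ℕ} (k l : Fin n) : ℂ[X] :=
  expN n (⟨n - k - 1, by have := k.2; omega⟩, l)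
    (⟨n - 1, by have := k.2; omega⟩, ⟨0, by have := k.2; omega⟩)

/-- The differential operator `∇ = -(1/(2πi)) d/dz`. -/
noncomputable def nabla (f : ℂ → ℂ) : ℂ → ℂ :=
  fun z => -(1 / (2 * Real.pi * Complex.I)) * deriv f z

/-- The operator `P(∇) = ∑ᵣ cᵣ ∇ʳ` for a polynomial `P = ∑ᵣ cᵣ Xʳ`. -/
noncomputable def polyNabla (P : ℂ[X]) (f : ℂ → ℂ) : ℂ → ℂ :=
  fun z => P.sum fun r c => c * (nabla^[r] f) z

/-- The operator `∇_{k,l}`. -/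
noncomputable def nablaOp {n : ℕ} (k l : Fin n) (f : ℂ → ℂ) : ℂ → ℂ :=
  polyNabla (nablaPoly k l) f

end JordanAYBE

namespace JordanAYBE

open Complex

/-! ### Quasi-periodic entire functions -/

/-! Write `jordan n = 1 + S` with `S` nilpotent, and seek the solution with value `Z` at `y₁` in the
form `∑ c_{k,l}(z) Sᵏ Z Sˡ`. Comparing coefficients, it suffices that `c_{k,l}(z+τ) + c_{k,l-1}(z+τ)
= e(z) (c_{k,l}(z) + c_{k-1,l}(z))`, terms of negative index being zero (`shiftSum_mul_jordan`). The
scalar quotient `s(z,u)` of `scalarSol` has multiplier `e(z,u)`, and `∇` is scaled so that `∇e = e`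
in the variable `u`. Hence `P(∇)(e s) = e P(∇+1) s`, and `c_{k,l} = P_{k,l}(∇) s` works as soon as
`P_{k,l}(X+1) + P_{k,l-1}(X+1) = P_{k,l}(X) + P_{k-1,l}(X)`.

The matrix `N` is built to solve this recurrence. Let `U` shift the blocks and `V` shift inside the
blocks; they commute and `N = log(1+U) - log(1+V)` (`matN_eq`). Therefore `(1+V) exp((X+1)N) = (1+U)
exp(XN)` (`expN_comp`), and one column of this identity is the recurrence (`nablaCoeff_comp`). As
`s(y₁,u) = 1` and `exp(0) = 1`, the resulting solution takes the value `Z` at `y₁`.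

Uniqueness (`eq_zero_of_mem_Sol`) is proved entry by entry. It rests on Fourier series: a 1-periodic
entire function with multiplier `μ e^{-2πiz}` is determined by its mean over a period
(`eq_zero_of_quasiPeriodic`). The same principle identifies the shifted third theta function with an
infinite product up to a nonzero constant, which controls all the zeros needed.

The formula then follows because `σ(u, y₂-y₁)` is a constant times `s(y₂,u)`, while `Z ↦ Sᵏ Z Sˡ`
corresponds to the inner sum of elementary tensors (`can_sum_e`). -/

theorem integral_add_eq_of_periodic {h : ℂ → ℂ} (hd : Differentiable ℂ h)
    (hp : Function.Periodic h 1) (w : ℂ) :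
    ∫ x in (0 : ℝ)..1, h (x + w) = ∫ x in (0 : ℝ)..1, h x := by
  -- Cauchy's theorem on the rectangle with opposite corners `0` and `1 + i Im w`: the vertical
  -- sides cancel by periodicity. The remaining shift by `Re w` is a real one.
  have key := integral_boundary_rect_eq_zero_of_differentiableOn h 0 (1 + w.im * I)
    hd.differentiableOn
  have hside : ∀ y : ℝ, h (1 + y * I) = h (y * I) := fun y => by
    rw [add_comm]
    exact hp _
  simp only [zero_re, zero_im, add_re, one_re, mul_re, ofReal_re, I_re, mul_zero, ofReal_im, I_im,
    mul_one, sub_self, add_zero, add_im, one_im, mul_im, zero_add, ofReal_zero, zero_mul,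
    ofReal_one, hside, add_sub_cancel_right] at key
  have hper : Function.Periodic (fun x : ℝ => h (x + w.im * I)) 1 := fun x => by
    simp only [ofReal_add, ofReal_one]
    rw [add_right_comm]
    exact hp _
  have hshift := hper.intervalIntegral_add_eq w.re 0
  rw [zero_add, ← sub_eq_zero.mp key] at hshift
  rw [← hshift, add_comm w.re 1,
    ← zero_add w.re, ← add_assoc, add_zero,
    ← intervalIntegral.integral_comp_add_right (fun x : ℝ => h (x + w.im * I))]
  refine intervalIntegral.integral_congr fun x _ => ?_
  simp only [ofReal_add]
  rw [add_assoc, re_add_im]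

/-- The zero family of Fourier coefficients is summable, so the Fourier series converges pointwise
to `f` on the real line; the identity theorem then passes to `ℂ`. -/
theorem eq_zero_of_integral_exp_eq_zero {f : ℂ → ℂ} (hd : Differentiable ℂ f)
    (hp : Function.Periodic f 1)
    (h0 : ∀ n : ℤ, ∫ x in (0 : ℝ)..1, f x * exp (-2 * Real.pi * I * n * x) = 0) : f = 0 := by
  have hpR : Function.Periodic (fun x : ℝ => f x) 1 := fun x => by
    simpa using hp x
  have hcont : Continuous (fun x : ℝ => f x) := hd.continuous.comp continuous_ofReal
  let F : C(AddCircle (1 : ℝ), ℂ) := ⟨hpR.lift, continuous_quot_lift _ hcont⟩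
  have hF : ∀ x : ℝ, F x = f x := fun x => hpR.lift_coe x
  have hcoef : fourierCoeff F = 0 := by
    funext n
    rw [fourierCoeff_eq_intervalIntegral _ n 0, zero_add, div_one, one_smul, Pi.zero_apply, ← h0 n]
    refine intervalIntegral.integral_congr fun x _ => ?_
    simp only [hF, fourier_coe_apply, smul_eq_mul]
    rw [mul_comm]
    congr 2
    push_cast
    ring
  have hzero : ∀ x : ℝ, f x = 0 := fun x => by
    have hs := has_pointwise_sum_fourier_series_of_summable (f := F)
      (by rw [hcoef]; exact summable_zero) (x : AddCircle (1 : ℝ))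
    simp only [hcoef, Pi.zero_apply, zero_smul] at hs
    rw [← hF]
    exact hs.unique hasSum_zero
  have han : AnalyticOnNhd ℂ f Set.univ := fun z _ => hd.analyticAt z
  refine han.eq_of_frequently_eq (g := 0) (z₀ := 0) (fun z _ => analyticAt_const) ?_
  have ht : Filter.Tendsto (fun x : ℝ => (x : ℂ)) (nhdsWithin 0 {0}ᶜ) (nhdsWithin 0 {0}ᶜ) := by
    refine tendsto_nhdsWithin_iff.2 ⟨?_, ?_⟩
    · exact (continuous_ofReal.tendsto' 0 0 (by simp)).mono_left nhdsWithin_le_nhds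
    · filter_upwards [self_mem_nhdsWithin] with x hx
      simpa using hx
  exact ht.frequently (Filter.Frequently.of_forall hzero)

/-- A quasi-periodic entire function of degree one vanishes if its mean over a period does. -/
theorem eq_zero_of_quasiPeriodic {f : ℂ → ℂ} {τ μ : ℂ} (hd : Differentiable ℂ f)
    (hp : ∀ z, f (z + 1) = f z) (hμ : μ ≠ 0)
    (hq : ∀ z, f (z + τ) = μ * exp (-2 * Real.pi * I * z) * f z)
    (h0 : ∫ x in (0 : ℝ)..1, f x = 0) : f = 0 := by
  set a : ℤ → ℂ := fun n => ∫ x in (0 : ℝ)..1, f x * exp (-2 * Real.pi * I * n * x) with ha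
  -- Moving the path of integration by `τ` and applying quasi-periodicity makes each Fourier
  -- coefficient a nonzero multiple of the next, so `a 0 = 0` propagates in both directions.
  have hrec : ∀ n : ℤ, a n = μ * exp (-2 * Real.pi * I * n * τ) * a (n + 1) := fun n => by
    have hinv := integral_add_eq_of_periodic
      (h := fun z => f z * exp (-2 * Real.pi * I * n * z)) (by fun_prop) (fun z => by
        simp only [hp]
        congr 1
        rw [mul_add, exp_add, mul_one,
          show -2 * Real.pi * I * (n : ℂ) = ((-n : ℤ) : ℂ) * (2 * Real.pi * I) by push_cast; ring,
          exp_int_mul_two_pi_mul_I, mul_one]) τ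
    rw [ha]
    dsimp only at hinv ⊢
    rw [← hinv, ← intervalIntegral.integral_const_mul]
    refine intervalIntegral.integral_congr fun x _ => ?_
    rw [hq]
    have : exp (-2 * Real.pi * I * x) * exp (-2 * Real.pi * I * n * (x + τ)) =
        exp (-2 * Real.pi * I * n * τ) * exp (-2 * Real.pi * I * ((n + 1 : ℤ) : ℂ) * x) := by
      rw [← exp_add, ← exp_add]
      congr 1
      push_cast
      ring
    linear_combination μ * f x * this
  have hz : a 0 = 0 := by simpa [ha] using h0
  refine eq_zero_of_integral_exp_eq_zero hd hp fun n => ?_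
  change a n = 0
  induction n using Int.induction_on with
  | zero => exact hz
  | succ i hi =>
    have := hrec i
    rw [hi, eq_comm, mul_eq_zero] at this
    exact this.resolve_left (mul_ne_zero hμ (exp_ne_zero _))
  | pred i hi => rw [hrec, sub_add_cancel, hi, mul_zero]

/-- The mean over a period is an injective linear functional on such functions, so they form a space
of dimension at most one; `c` is the ratio of the means. -/
theorem exists_eq_mul_of_quasiPeriodic {f g : ℂ → ℂ} {τ μ : ℂ} (hμ : μ ≠ 0)
    (hf : Differentiable ℂ f) (hf1 : ∀ z, f (z + 1) = f z)
    (hfq : ∀ z, f (z + τ) = μ * exp (-2 * Real.pi * I * z) * f z)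
    (hg : Differentiable ℂ g) (hg1 : ∀ z, g (z + 1) = g z)
    (hgq : ∀ z, g (z + τ) = μ * exp (-2 * Real.pi * I * z) * g z) (hg0 : g ≠ 0) :
    ∃ c : ℂ, ∀ z, f z = c * g z := by
  set A : (ℂ → ℂ) → ℂ := fun h => ∫ x in (0 : ℝ)..1, h x with hA
  have hgA : A g ≠ 0 := fun h => hg0 (eq_zero_of_quasiPeriodic hg hg1 hμ hgq h)
  refine ⟨A f / A g, fun z => ?_⟩
  have hint : ∀ h : ℂ → ℂ, Differentiable ℂ h →
      IntervalIntegrable (fun x : ℝ => h x) MeasureTheory.volume 0 1 := fun h hh =>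
    (hh.continuous.comp continuous_ofReal).intervalIntegrable _ _
  have hdiff : Differentiable ℂ fun z => f z - A f / A g * g z := by fun_prop
  have := eq_zero_of_quasiPeriodic (τ := τ) hdiff
    (fun z => by rw [hf1, hg1]) hμ (fun z => by rw [hfq, hgq]; ring) (by
      rw [intervalIntegral.integral_sub (hint _ hf) ((hint _ hg).const_mul _),
        intervalIntegral.integral_const_mul]
      change A f - A f / A g * A g = 0
      rw [div_mul_cancel₀ _ hgA, sub_self])
  exact sub_eq_zero.mp (congrFun this z)

/-! ### The infinite product `∏ (1 - pᵐ x)` -/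

/-- The infinite product `∏_{m ≥ 0} (1 - pᵐ x)`. -/
noncomputable def pochhammerInf (p x : ℂ) : ℂ := ∏' m : ℕ, (1 + -(p ^ m * x))

theorem summable_norm_pow_mul {p : ℂ} (hp : ‖p‖ < 1) (x : ℂ) :
    Summable fun m : ℕ => ‖-(p ^ m * x)‖ := by
  simp only [norm_neg, norm_mul, norm_pow]
  exact (summable_geometric_of_lt_one (norm_nonneg _) hp).mul_right _

theorem pochhammerInf_eq_mul {p : ℂ} (hp : ‖p‖ < 1) (x : ℂ) :
    pochhammerInf p x = (1 - x) * pochhammerInf p (p * x) := by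
  have hm : Multipliable fun m : ℕ => 1 + -(p ^ m * (p * x)) :=
    multipliable_one_add_of_summable (summable_norm_pow_mul hp (p * x))
  have hs : ∀ m : ℕ, 1 + -(p ^ (m + 1) * x) = 1 + -(p ^ m * (p * x)) := fun m => by ring
  have hmul : ∏' m : ℕ, (1 + -(p ^ m * x)) =
      (1 + -(p ^ 0 * x)) * ∏' m : ℕ, (1 + -(p ^ (m + 1) * x)) :=
    tprod_eq_zero_mul' (f := fun m : ℕ => 1 + -(p ^ m * x)) (by simpa only [hs] using hm)
  rw [pochhammerInf, hmul, tprod_congr hs, pochhammerInf]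
  ring

theorem pochhammerInf_ne_zero {p : ℂ} (hp : ‖p‖ < 1) {x : ℂ} (hx : ∀ m : ℕ, p ^ m * x ≠ 1) :
    pochhammerInf p x ≠ 0 := by
  refine tprod_one_add_ne_zero_of_summable (fun m => ?_) (summable_norm_pow_mul hp x)
  rw [← sub_eq_add_neg, sub_ne_zero]
  exact (hx m).symm

theorem differentiable_pochhammerInf {p : ℂ} (hp : ‖p‖ < 1) :
    Differentiable ℂ (pochhammerInf p) := by
  intro x
  have hu : Summable fun m : ℕ => ‖p‖ ^ m * (‖x‖ + 1) :=
    (summable_geometric_of_lt_one (norm_nonneg _) hp).mul_right _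
  have hprod := hu.hasProdLocallyUniformlyOn_nat_one_add (f := fun m z => -(p ^ m * z))
    (K := Metric.ball x 1) Metric.isOpen_ball (Filter.Eventually.of_forall fun m z hz => by
      rw [norm_neg, norm_mul, norm_pow]
      refine mul_le_mul_of_nonneg_left ?_ (by positivity)
      have h1 : ‖z - x‖ < 1 := mem_ball_iff_norm.mp hz
      have h2 : ‖z‖ ≤ ‖x‖ + ‖z - x‖ := norm_le_norm_add_norm_sub' z x
      linarith) (fun m => by fun_prop)
  exact (hprod.differentiableOn (Filter.Eventually.of_forall fun s => by
    simpa [Finset.prod_fn] using DifferentiableOn.finsetProd (fun _ _ => by fun_prop))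
    Metric.isOpen_ball).differentiableAt (Metric.ball_mem_nhds x one_pos)

/-! ### Zeros of the theta functions -/

/-- The function `θ̄(z + (τ+1)/2)`, whose zeros are the points of the lattice. -/
noncomputable def thetaShift (τ z : ℂ) : ℂ := thetaBar τ (z + (τ + 1) / 2)

/-- The infinite product with simple zeros at the points of the lattice. -/
noncomputable def thetaProd (τ z : ℂ) : ℂ :=
  pochhammerInf (exp (2 * Real.pi * I * τ)) (exp (2 * Real.pi * I * (z + τ))) *
    pochhammerInf (exp (2 * Real.pi * I * τ)) (exp (-(2 * Real.pi * I * z)))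

theorem norm_exp_lt_one {τ : ℂ} (hτ : 0 < τ.im) : ‖exp (2 * Real.pi * I * τ)‖ < 1 := by
  rw [norm_exp, Real.exp_lt_one_iff]
  have h : (2 * Real.pi * I * τ).re = -(2 * Real.pi * τ.im) := by simp
  rw [h]
  have := mul_pos (mul_pos two_pos Real.pi_pos) hτ
  linarith

theorem differentiable_thetaShift {τ : ℂ} (hτ : 0 < τ.im) : Differentiable ℂ (thetaShift τ) := by
  intro z
  exact (differentiableAt_jacobiTheta₂_fst (z + (τ + 1) / 2) hτ).comp z
    (differentiableAt_id.add_const _)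

theorem thetaShift_add_one (τ z : ℂ) : thetaShift τ (z + 1) = thetaShift τ z := by
  rw [thetaShift, thetaBar, add_right_comm, jacobiTheta₂_add_left]
  rfl

theorem thetaShift_add_tau (τ z : ℂ) :
    thetaShift τ (z + τ) = -exp (-2 * Real.pi * I * τ) * exp (-2 * Real.pi * I * z) *
      thetaShift τ z := by
  rw [thetaShift, thetaBar, add_right_comm, jacobiTheta₂_add_left', thetaShift, thetaBar]
  congr 1
  rw [neg_mul (exp _) (exp _), ← exp_add, ← mul_neg_one (exp _), ← exp_pi_mul_I, ← exp_add]
  rw [show -2 * Real.pi * I * τ + -2 * Real.pi * I * z + Real.pi * I =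
    -Real.pi * I * (τ + 2 * (z + (τ + 1) / 2)) + 2 * Real.pi * I by ring,
    exp_periodic]

theorem differentiable_thetaProd {τ : ℂ} (hτ : 0 < τ.im) : Differentiable ℂ (thetaProd τ) := by
  have h := differentiable_pochhammerInf (norm_exp_lt_one hτ)
  unfold thetaProd
  fun_prop

theorem thetaProd_add_one (τ z : ℂ) : thetaProd τ (z + 1) = thetaProd τ z := by
  have h1 : exp (2 * Real.pi * I * (z + 1 + τ)) = exp (2 * Real.pi * I * (z + τ)) := by
    rw [show 2 * Real.pi * I * (z + 1 + τ) = 2 * Real.pi * I * (z + τ) + 2 * Real.pi * I by ring,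
      exp_periodic]
  have h2 : exp (-(2 * Real.pi * I * (z + 1))) = exp (-(2 * Real.pi * I * z)) := by
    rw [exp_neg, mul_add, mul_one, exp_periodic, exp_neg]
  rw [thetaProd, h1, h2, thetaProd]

/-- With `w = e^{2πi(z+τ)}`, translation by `τ` removes the factor `1 - w` from one product and adds
`1 - w⁻¹` to the other; their ratio is `-w⁻¹`. -/
theorem thetaProd_add_tau {τ : ℂ} (hτ : 0 < τ.im) (z : ℂ) :
    thetaProd τ (z + τ) = -exp (-2 * Real.pi * I * τ) * exp (-2 * Real.pi * I * z) *
      thetaProd τ z := by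
  have hp := norm_exp_lt_one hτ
  set p := exp (2 * Real.pi * I * τ) with hpdef
  have e1 : exp (2 * Real.pi * I * (z + τ + τ)) = p * exp (2 * Real.pi * I * (z + τ)) := by
    rw [hpdef, ← exp_add]; ring_nf
  have e2 : exp (-(2 * Real.pi * I * z)) = p * exp (-(2 * Real.pi * I * (z + τ))) := by
    rw [hpdef, ← exp_add]; ring_nf
  have e3 : exp (-2 * Real.pi * I * τ) * exp (-2 * Real.pi * I * z) =
      exp (-(2 * Real.pi * I * (z + τ))) := by
    rw [← exp_add]; ring_nf
  have e4 : exp (-(2 * Real.pi * I * (z + τ))) * exp (2 * Real.pi * I * (z + τ)) = 1 := by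
    rw [← exp_add, neg_add_cancel, exp_zero]
  rw [thetaProd, thetaProd, ← hpdef, e1, neg_mul, e3,
    pochhammerInf_eq_mul hp (exp (2 * Real.pi * I * (z + τ))),
    pochhammerInf_eq_mul hp (exp (-(2 * Real.pi * I * (z + τ)))), ← e2]
  linear_combination -pochhammerInf p (p * exp (2 * Real.pi * I * (z + τ))) *
    pochhammerInf p (exp (-(2 * Real.pi * I * z))) * e4

theorem mem_lattice_of_exp_eq_one {τ z : ℂ} (m : ℤ)
    (h : exp (2 * Real.pi * I * (z + m * τ)) = 1) : z ∈ lattice τ := by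
  obtain ⟨k, hk⟩ := exp_eq_one_iff.mp h
  refine ⟨k, -m, ?_⟩
  rw [mul_comm] at hk
  have := mul_right_cancel₀ two_pi_I_ne_zero hk
  push_cast
  linear_combination this

theorem thetaProd_ne_zero {τ z : ℂ} (hτ : 0 < τ.im) (hz : z ∉ lattice τ) : thetaProd τ z ≠ 0 := by
  refine mul_ne_zero (pochhammerInf_ne_zero (norm_exp_lt_one hτ) fun m hm => hz ?_)
    (pochhammerInf_ne_zero (norm_exp_lt_one hτ) fun m hm => hz ?_)
  · refine mem_lattice_of_exp_eq_one (m + 1 : ℤ) ?_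
    rw [← exp_nat_mul, ← exp_add] at hm
    rw [← hm]
    push_cast
    ring_nf
  · refine mem_lattice_of_exp_eq_one (-m : ℤ) ?_
    rw [← exp_nat_mul, ← exp_add] at hm
    rw [← inv_eq_one, ← exp_neg, ← hm]
    push_cast
    ring_nf

theorem exists_notMem_lattice {τ : ℂ} (hτ : 0 < τ.im) : ∃ z : ℂ, z ∉ lattice τ := by
  refine ⟨τ / 2, ?_⟩
  rintro ⟨a, b, h⟩
  have him := congrArg im h
  have h2 : τ.im / 2 = b * τ.im := by simpa using him
  have h3 : (1 : ℝ) = 2 * b := by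
    have : τ.im * (1 - 2 * b) = 0 := by linarith
    have := (mul_eq_zero.mp this).resolve_left hτ.ne'
    linarith
  have h4 : (1 : ℤ) = 2 * b := by exact_mod_cast h3
  omega

/-- Only the constant Fourier mode survives. This excludes that the theta function vanishes
identically. -/
theorem integral_jacobiTheta₂ {τ : ℂ} (hτ : 0 < τ.im) :
    ∫ x in (0 : ℝ)..1, jacobiTheta₂ x τ = 1 := by
  have hb : ∀ (n : ℤ) (x : ℝ), ‖jacobiTheta₂_term n x τ‖ = ‖jacobiTheta₂_term n 0 τ‖ :=
    fun n x => by simp [norm_jacobiTheta₂_term]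
  have hsum := intervalIntegral.hasSum_integral_of_dominated_convergence
    (F := fun (n : ℤ) (x : ℝ) => jacobiTheta₂_term n x τ) (f := fun x : ℝ => jacobiTheta₂ x τ)
    (a := 0) (b := 1) (μ := MeasureTheory.volume)
    (fun n _ => ‖jacobiTheta₂_term n 0 τ‖)
    (fun n => by
      refine Continuous.aestronglyMeasurable ?_
      unfold jacobiTheta₂_term
      fun_prop)
    (fun n => Filter.Eventually.of_forall fun x _ => (hb n x).le)
    (Filter.Eventually.of_forall fun x _ => (summable_jacobiTheta₂_term_iff 0 τ).2 hτ |>.norm)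
    (by simp)
    (Filter.Eventually.of_forall fun x _ => hasSum_jacobiTheta₂_term x hτ)
  have hint : ∀ n : ℤ, ∫ x in (0 : ℝ)..1, jacobiTheta₂_term n x τ = if n = 0 then 1 else 0 := by
    intro n
    split_ifs with hn
    · simp [hn, jacobiTheta₂_term]
    · have hc : 2 * Real.pi * I * (n : ℂ) ≠ 0 := mul_ne_zero two_pi_I_ne_zero (by exact_mod_cast hn)
      simp only [jacobiTheta₂_term, exp_add]
      rw [intervalIntegral.integral_mul_const, integral_exp_mul_complex hc,
        ofReal_one, mul_one, mul_comm _ (n : ℂ), exp_int_mul_two_pi_mul_I]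
      simp
  simp only [hint] at hsum
  exact hsum.unique (hasSum_ite_eq 0 1)

/-- The Jacobi triple product with its constant left undetermined: both sides have the same
multipliers, and `c = 0` would contradict the mean value one. -/
theorem exists_thetaShift_eq {τ : ℂ} (hτ : 0 < τ.im) :
    ∃ c : ℂ, c ≠ 0 ∧ ∀ z, thetaShift τ z = c * thetaProd τ z := by
  obtain ⟨w, hw⟩ := exists_notMem_lattice hτ
  obtain ⟨c, hc⟩ := exists_eq_mul_of_quasiPeriodic (neg_ne_zero.2 (exp_ne_zero _))
    (differentiable_thetaShift hτ) (thetaShift_add_one τ) (thetaShift_add_tau τ)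
    (differentiable_thetaProd hτ) (thetaProd_add_one τ) (thetaProd_add_tau hτ)
    (fun h => thetaProd_ne_zero hτ hw (congrFun h w))
  refine ⟨c, fun h0 => ?_, hc⟩
  have hz : ∀ z, jacobiTheta₂ z τ = 0 := fun z => by
    have := hc (z - (τ + 1) / 2)
    rwa [h0, zero_mul, thetaShift, sub_add_cancel] at this
  have := integral_jacobiTheta₂ hτ
  simp [hz] at this

theorem thetaShift_ne_zero {τ z : ℂ} (hτ : 0 < τ.im) (hz : z ∉ lattice τ) :
    thetaShift τ z ≠ 0 := by
  obtain ⟨c, hc, h⟩ := exists_thetaShift_eq hτ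
  rw [h]
  exact mul_ne_zero hc (thetaProd_ne_zero hτ hz)

/-- The terms of index `m` and `-m-1` of the two-sided series combine to the sine of `(2m+1)πz`. -/
theorem theta_eq_thetaShift {τ : ℂ} (hτ : 0 < τ.im) (z : ℂ) :
    theta τ z = exp (Real.pi * I * τ / 4) / I * (exp (Real.pi * I * z) * thetaShift τ z) := by
  have hsum := ((hasSum_jacobiTheta₂_term (z + (τ + 1) / 2) hτ).mul_left
    (exp (Real.pi * I * z))).nat_add_neg_add_one
  have hterm : ∀ m : ℕ,
      exp (Real.pi * I * z) * jacobiTheta₂_term m (z + (τ + 1) / 2) τ +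
        exp (Real.pi * I * z) * jacobiTheta₂_term (-(m + 1)) (z + (τ + 1) / 2) τ =
      2 * I * ((-1) ^ m * exp (Real.pi * I * τ) ^ (m * (m + 1)) *
        sin ((2 * m + 1) * Real.pi * z)) := fun m => by
    have h1 : exp (Real.pi * I * z) * jacobiTheta₂_term m (z + (τ + 1) / 2) τ =
        (-1) ^ m * exp (Real.pi * I * τ) ^ (m * (m + 1)) *
          exp ((2 * m + 1) * Real.pi * z * I) := by
      rw [jacobiTheta₂_term, ← exp_pi_mul_I, ← exp_nat_mul, ← exp_nat_mul, ← exp_add, ← exp_add,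
        ← exp_add]
      congr 1
      push_cast
      ring
    have h2 : exp (Real.pi * I * z) * jacobiTheta₂_term (-(m + 1)) (z + (τ + 1) / 2) τ =
        -((-1) ^ m * exp (Real.pi * I * τ) ^ (m * (m + 1)) *
          exp (-((2 * m + 1) * Real.pi * z) * I)) := by
      have hm : -((-1 : ℂ) ^ m) = exp (-((m + 1 : ℕ) * (Real.pi * I))) := by
        rw [exp_neg, exp_nat_mul, exp_pi_mul_I, ← inv_pow, inv_neg_one, pow_succ]
        ring
      rw [← neg_mul, ← neg_mul, hm, jacobiTheta₂_term, ← exp_nat_mul, ← exp_add, ← exp_add,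
        ← exp_add]
      congr 1
      push_cast
      ring
    rw [h1, h2, sin]
    linear_combination (-1) ^ m * exp (Real.pi * I * τ) ^ (m * (m + 1)) *
      (exp (-((2 * m + 1) * Real.pi * z) * I) - exp ((2 * m + 1) * Real.pi * z * I)) * (-I_sq)
  simp only [hterm] at hsum
  have := hsum.tsum_eq
  rw [tsum_mul_left] at this
  rw [theta, thetaShift, thetaBar, ← this, ← mul_assoc (_ / I)]
  congr 1
  field_simp

theorem thetaProd_zero (τ : ℂ) (hτ : 0 < τ.im) : thetaProd τ 0 = 0 := by
  rw [thetaProd, pochhammerInf_eq_mul (norm_exp_lt_one hτ) (exp (-(2 * Real.pi * I * 0)))]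
  simp

/-- Splitting off the factor `1 - e^{-2πiz}`, which has a simple zero at `0`, leaves a cofactor
whose value there is the square of `∏_{m≥1} (1 - pᵐ) ≠ 0`. -/
theorem deriv_thetaProd_zero_ne_zero {τ : ℂ} (hτ : 0 < τ.im) : deriv (thetaProd τ) 0 ≠ 0 := by
  have hp := norm_exp_lt_one hτ
  set p := exp (2 * Real.pi * I * τ) with hpdef
  have hGd := differentiable_pochhammerInf hp
  have hG : pochhammerInf p p ≠ 0 := pochhammerInf_ne_zero hp fun m hm => by
    have h1 : ‖p‖ ^ (m + 1) = 1 := by rw [← norm_pow, pow_succ, hm, norm_one]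
    exact (pow_lt_one₀ (norm_nonneg _) hp m.succ_ne_zero).ne h1
  set H : ℂ → ℂ := fun z => pochhammerInf p (exp (2 * Real.pi * I * (z + τ))) *
    pochhammerInf p (p * exp (-(2 * Real.pi * I * z))) with hH
  have hHd : Differentiable ℂ H := by fun_prop
  have heq : thetaProd τ = fun z => (1 - exp (-(2 * Real.pi * I * z))) * H z := by
    funext z
    rw [thetaProd, ← hpdef, pochhammerInf_eq_mul hp (exp (-(2 * Real.pi * I * z)))]
    ring
  have hfac : HasDerivAt (fun z : ℂ => 1 - exp (-(2 * Real.pi * I * z)))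
      (-(exp (-(2 * Real.pi * I * 0)) * -(2 * Real.pi * I * 1))) 0 :=
    (((hasDerivAt_id (0 : ℂ)).const_mul (2 * Real.pi * I)).neg.cexp).const_sub 1
  rw [heq, (hfac.fun_mul (hHd 0).hasDerivAt).deriv]
  have hH0 : H 0 = pochhammerInf p p * pochhammerInf p p := by simp [hH, ← hpdef]
  simp only [mul_zero, neg_zero, exp_zero, sub_self, zero_mul, add_zero, hH0]
  simp [hG]

theorem deriv_theta_zero_ne_zero {τ : ℂ} (hτ : 0 < τ.im) : deriv (theta τ) 0 ≠ 0 := by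
  obtain ⟨c, hc, h⟩ := exists_thetaShift_eq hτ
  have heq : theta τ = fun z =>
      exp (Real.pi * I * τ / 4) / I * (exp (Real.pi * I * z) * (c * thetaProd τ z)) := by
    funext z
    rw [theta_eq_thetaShift hτ, h]
  have hd := ((((hasDerivAt_id (0 : ℂ)).const_mul (Real.pi * I)).cexp).mul
    (((differentiable_thetaProd hτ) 0).hasDerivAt.const_mul c)).const_mul
      (exp (Real.pi * I * τ / 4) / I)
  have hval := hd.deriv
  simp only [id, thetaProd_zero τ hτ, mul_zero, zero_add, exp_zero, one_mul] at hval
  rw [heq]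
  refine ne_of_eq_of_ne hval ?_
  exact mul_ne_zero (div_ne_zero (exp_ne_zero _) I_ne_zero)
    (mul_ne_zero hc (deriv_thetaProd_zero_ne_zero hτ))

theorem theta_ne_zero {τ z : ℂ} (hτ : 0 < τ.im) (hz : z ∉ lattice τ) : theta τ z ≠ 0 := by
  rw [theta_eq_thetaShift hτ]
  exact mul_ne_zero (div_ne_zero (exp_ne_zero _) I_ne_zero)
    (mul_ne_zero (exp_ne_zero _) (thetaShift_ne_zero hτ hz))

/-- The Kronecker function in terms of the shifted third theta function. -/
theorem sigma_eq_thetaShift {τ : ℂ} (hτ : 0 < τ.im) (u x : ℂ) :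
    sigma τ u x = deriv (theta τ) 0 / (exp (Real.pi * I * τ / 4) / I) *
      (thetaShift τ (u + x) / (thetaShift τ u * thetaShift τ x)) := by
  have hk : exp (Real.pi * I * τ / 4) / I ≠ 0 := div_ne_zero (exp_ne_zero _) I_ne_zero
  rw [sigma, theta_eq_thetaShift hτ (u + x), theta_eq_thetaShift hτ u, theta_eq_thetaShift hτ x,
    mul_add (Real.pi * I), exp_add]
  generalize exp (Real.pi * I * τ / 4) / I = k at hk ⊢
  have h1 := exp_ne_zero (Real.pi * I * u)
  have h2 := exp_ne_zero (Real.pi * I * x)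
  generalize exp (Real.pi * I * u) = a at h1 ⊢
  generalize exp (Real.pi * I * x) = b at h2 ⊢
  -- At zeros of the denominators both sides are `0` by the convention for division by zero.
  by_cases hu : thetaShift τ u = 0
  · simp [hu]
  by_cases hx : thetaShift τ x = 0
  · simp [hx]
  field_simp

/-! ### The exponential of the truncated logarithm of a nilpotent element -/

open Polynomial in
/-- The series of `log (1 + X)`, truncated at degree `n`. -/
noncomputable def logPoly (n : ℕ) : ℂ[X] := -∑ k ∈ Finset.range n, C (coeffA k) * X ^ k

open Polynomial in
theorem X_dvd_logPoly (n : ℕ) : X ∣ logPoly n := by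
  refine (Finset.dvd_sum fun k _ => ?_).neg_right
  rcases k.eq_zero_or_pos with rfl | hk
  -- The term `k = 0` is absent, since `coeffA 0 = 1 / 0 = 0`.
  · simp [coeffA]
  · exact (dvd_pow_self X hk.ne').mul_left _

open Polynomial in
theorem one_add_X_mul_derivative_logPoly (n : ℕ) :
    (1 + X) * derivative (logPoly (n + 1)) = 1 - (-X) ^ n := by
  have h : derivative (logPoly (n + 1)) = ∑ k ∈ Finset.range n, (-X) ^ k := by
    rw [logPoly, derivative_neg, derivative_sum, Finset.sum_range_succ']
    simp only [derivative_C_mul_X_pow, coeffA, Nat.cast_zero, div_zero, zero_mul, map_zero,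
      add_zero, ← Finset.sum_neg_distrib]
    refine Finset.sum_congr rfl fun k _ => ?_
    have hk : ((k + 1 : ℕ) : ℂ) ≠ 0 := by exact_mod_cast k.succ_ne_zero
    rw [div_mul_cancel₀ _ hk, Nat.add_sub_cancel, neg_pow (X : ℂ[X]) k, pow_succ]
    simp
  have := mul_neg_geom_sum (-X : ℂ[X]) n
  rw [h, ← this, sub_neg_eq_add]

open Polynomial in
/-- A polynomial `q` with `q(0) = 0` and `(1 + X) q' = q` up to degree `n` vanishes up to degree
`n`. -/
theorem X_pow_dvd_of_derivative {q : ℂ[X]} {n : ℕ} (h0 : q.coeff 0 = 0)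
    (h : X ^ n ∣ (1 + X) * derivative q - q) : X ^ (n + 1) ∣ q := by
  rw [X_pow_dvd_iff] at h ⊢
  intro d hd
  -- The coefficient of `X^d` in the hypothesis is `(d+1) q_{d+1} + d q_d - q_d`, so `q_d = 0`
  -- forces `q_{d+1} = 0`.
  induction d with
  | zero => exact h0
  | succ d ih =>
    have hd' := h d (by omega)
    have hq := ih (by omega)
    have hX : (X * derivative q).coeff d = 0 := by
      cases d with
      | zero => simp
      | succ d => rw [coeff_X_mul, coeff_derivative, hq, zero_mul]
    rw [coeff_sub, add_mul, one_mul, coeff_add, hX, hq, coeff_derivative, add_zero, sub_zero] at hd'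
    exact (mul_eq_zero.mp hd').resolve_right (by exact_mod_cast d.succ_ne_zero)

open Polynomial in
-- Both the truncated exponential `y` of the truncated logarithm and `1 + X` satisfy `(1+X) y' = y`
-- modulo `X^n` and have constant term one, so they agree modulo `X^(n+1)`.
theorem X_pow_dvd_exp_logPoly (n : ℕ) :
    X ^ (n + 1) ∣ (∑ r ∈ Finset.range (n + 2), (r.factorial : ℚ)⁻¹ • logPoly (n + 1) ^ r) -
      (1 + X) := by
  set L := logPoly (n + 1) with hL
  set T := ∑ r ∈ Finset.range (n + 1), (r.factorial : ℚ)⁻¹ • L ^ r with hT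
  set y := ∑ r ∈ Finset.range (n + 2), (r.factorial : ℚ)⁻¹ • L ^ r with hy
  have hLX : X ∣ L := X_dvd_logPoly _
  have hyT : y = T + ((n + 1).factorial : ℚ)⁻¹ • L ^ (n + 1) := Finset.sum_range_succ _ _
  have hder : derivative y = T * derivative L := by
    rw [hy, Finset.sum_range_succ', map_add, map_sum, hT, Finset.sum_mul]
    simp only [pow_zero, Nat.factorial_zero, derivative_smul, derivative_one, smul_zero, add_zero]
    refine Finset.sum_congr rfl fun r _ => ?_
    have hfac : ((r + 1).factorial : ℚ)⁻¹ * (r + 1 : ℕ) = (r.factorial : ℚ)⁻¹ := by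
      rw [Nat.factorial_succ]
      have := r.factorial_ne_zero
      push_cast
      field_simp
    rw [derivative_pow, Nat.add_sub_cancel, smul_mul_assoc, mul_assoc, ← hfac, mul_smul, map_natCast,
      ← nsmul_eq_mul, Nat.cast_smul_eq_nsmul]
  refine X_pow_dvd_of_derivative ?_ ?_
  · obtain ⟨M, hM⟩ := hLX
    rw [coeff_zero_eq_eval_zero, hy, Finset.sum_range_succ', eval_sub, eval_add, eval_finsetSum]
    simp [hM]
  · have h1 : X ^ n ∣ L ^ (n + 1) := (pow_dvd_pow _ n.le_succ).trans (pow_dvd_pow_of_dvd hLX _)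
    have h2 : (1 + X) * derivative (y - (1 + X)) - (y - (1 + X)) =
        -((-1) ^ n * T) * X ^ n - ((n + 1).factorial : ℚ)⁻¹ • L ^ (n + 1) := by
      have h3 := one_add_X_mul_derivative_logPoly n
      rw [neg_pow] at h3
      have h4 : derivative (1 + X : ℂ[X]) = 1 := by simp
      rw [derivative_sub, hder, h4, hyT]
      linear_combination T * h3
    rw [h2]
    refine dvd_sub (dvd_mul_left _ _) ?_
    rw [← one_mul (L ^ (n + 1)), ← smul_mul_assoc]
    exact h1.mul_left _

open Polynomial in
theorem exp_aeval_logPoly {A : Type*} [Ring A] [Algebra ℂ A] [Module ℚ A] {u : A} {n : ℕ}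
    (hn : 1 ≤ n) (hu : u ^ n = 0) : IsNilpotent.exp (aeval u (logPoly n)) = 1 + u := by
  obtain ⟨n, rfl⟩ := Nat.exists_eq_add_of_le' hn
  have hz : ∀ P : ℂ[X], X ^ (n + 1) ∣ P → aeval u P = 0 := by
    rintro _ ⟨Q, rfl⟩
    rw [map_mul, map_pow, aeval_X, hu, zero_mul]
  have hpow : aeval u (logPoly (n + 1)) ^ (n + 2) = 0 := by
    rw [← map_pow]
    exact hz _ ((pow_dvd_pow _ (by omega)).trans (pow_dvd_pow_of_dvd (X_dvd_logPoly _) (n + 2)))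
  have := hz _ (X_pow_dvd_exp_logPoly n)
  rw [map_sub, sub_eq_zero, map_sum] at this
  rw [IsNilpotent.exp_eq_sum hpow]
  simpa [map_rat_smul] using this

/-! ### The matrix `N` as a difference of logarithms -/

open Polynomial in
theorem aeval_logPoly_pow_eq_zero {A : Type*} [Ring A] [Algebra ℂ A] {u : A} {n : ℕ}
    (hu : u ^ n = 0) : aeval u (logPoly n) ^ n = 0 := by
  obtain ⟨Q, hQ⟩ := X_dvd_logPoly n
  rw [hQ, mul_comm, ← map_pow, mul_pow, map_mul, map_pow _ X, aeval_X, hu, mul_zero]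

/-- The nilpotent matrix with ones on the first superdiagonal. -/
def superdiag (n : ℕ) : Mat n := Matrix.of fun p q => if (p : ℕ) + 1 = q then 1 else 0

theorem superdiag_apply (n : ℕ) (p q : Fin n) :
    superdiag n p q = if (p : ℕ) + 1 = q then 1 else 0 := rfl

theorem jordan_eq (n : ℕ) : jordan n = 1 + superdiag n := by
  ext p q
  simp only [jordan, superdiag, Matrix.of_apply, Matrix.add_apply, Matrix.one_apply]
  by_cases h : p = q
  · subst h; simp
  · simp [h]

theorem superdiag_pow_apply (n k : ℕ) (p q : Fin n) :
    (superdiag n ^ k) p q = if (p : ℕ) + k = q then 1 else 0 := by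
  induction k generalizing q with
  | zero => simp [Matrix.one_apply, Fin.ext_iff]
  | succ k ih =>
    rw [pow_succ, Matrix.mul_apply]
    simp only [ih, superdiag_apply, ite_mul, one_mul, zero_mul]
    by_cases h : (p : ℕ) + k < n
    · rw [Finset.sum_eq_single ⟨p + k, h⟩]
      · simp [add_assoc]
      · intro b _ hb
        rw [if_neg fun h' => hb (Fin.ext h'.symm)]
      · simp
    · rw [if_neg (by omega)]
      refine Finset.sum_eq_zero fun b _ => if_neg (by omega)

theorem superdiag_pow_eq_zero (n : ℕ) : superdiag n ^ n = 0 := by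
  ext p q
  rw [superdiag_pow_apply, if_neg (by omega), Matrix.zero_apply]

open scoped Kronecker

/-- The block matrix that shifts the blocks. -/
def outerShift (n : ℕ) : Matrix (Fin n × Fin n) (Fin n × Fin n) ℂ := superdiag n ⊗ₖ 1

/-- The block diagonal matrix that shifts inside the blocks. -/
def innerShift (n : ℕ) : Matrix (Fin n × Fin n) (Fin n × Fin n) ℂ :=
  1 ⊗ₖ (superdiag n).transpose

theorem outerShift_pow (n k : ℕ) : outerShift n ^ k = (superdiag n ^ k) ⊗ₖ 1 := by
  induction k with
  | zero => simp
  | succ k ih => rw [pow_succ, ih, outerShift, ← Matrix.mul_kronecker_mul, pow_succ, mul_one]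

theorem innerShift_pow (n k : ℕ) : innerShift n ^ k = 1 ⊗ₖ (superdiag n ^ k).transpose := by
  induction k with
  | zero => simp
  | succ k ih =>
    rw [pow_succ, ih, innerShift, ← Matrix.mul_kronecker_mul, pow_succ', Matrix.transpose_mul,
      mul_one]

theorem outerShift_pow_eq_zero (n : ℕ) : outerShift n ^ n = 0 := by
  rw [outerShift_pow, superdiag_pow_eq_zero, Matrix.zero_kronecker]

theorem innerShift_pow_eq_zero (n : ℕ) : innerShift n ^ n = 0 := by
  rw [innerShift_pow, superdiag_pow_eq_zero, Matrix.transpose_zero, Matrix.kronecker_zero]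

theorem commute_outerShift_innerShift (n : ℕ) : Commute (outerShift n) (innerShift n) := by
  rw [Commute, SemiconjBy, outerShift, innerShift, ← Matrix.mul_kronecker_mul,
    ← Matrix.mul_kronecker_mul]
  simp

theorem sum_coeffA_ite {n : ℕ} (p q : Fin n) :
    ∑ k ∈ Finset.range n, coeffA k * (if (p : ℕ) + k = q then 1 else 0) =
      if p < q then coeffA ((q : ℕ) - p) else 0 := by
  split_ifs with h
  · rw [Finset.sum_eq_single ((q : ℕ) - p)]
    · rw [if_pos (by omega), mul_one]
    · intro b _ hb
      rw [if_neg (by omega), mul_zero]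
    · intro h'
      exact absurd (Finset.mem_range.2 (by omega)) h'
  · refine Finset.sum_eq_zero fun k _ => ?_
    split_ifs with hk
    · have : k = 0 := by omega
      simp [this, coeffA]
    · rw [mul_zero]

open Polynomial in
-- The diagonal blocks `A_0` are the powers of `V` with coefficients `a_k`, and the blocks above the
-- diagonal are the powers of `U` with coefficients `-a_k`.
theorem matN_eq (n : ℕ) :
    matN n = aeval (outerShift n) (logPoly n) - aeval (innerShift n) (logPoly n) := by
  ext ⟨x, p⟩ ⟨y, q⟩
  have h1 : aeval (outerShift n) (logPoly n) (x, p) (y, q) =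
      -((if x < y then coeffA ((y : ℕ) - x) else 0) * (1 : Mat n) p q) := by
    rw [← sum_coeffA_ite, logPoly, map_neg, map_sum, Matrix.neg_apply, Matrix.sum_apply,
      Finset.sum_mul]
    congr 1
    refine Finset.sum_congr rfl fun k _ => ?_
    rw [map_mul, map_pow, aeval_X, aeval_C, ← Algebra.smul_def, Matrix.smul_apply, outerShift_pow,
      Matrix.kronecker_apply, superdiag_pow_apply, smul_eq_mul, mul_assoc]
  have h2 : aeval (innerShift n) (logPoly n) (x, p) (y, q) =
      -((if q < p then coeffA ((p : ℕ) - q) else 0) * (1 : Mat n) x y) := by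
    rw [← sum_coeffA_ite, logPoly, map_neg, map_sum, Matrix.neg_apply, Matrix.sum_apply,
      Finset.sum_mul]
    congr 1
    refine Finset.sum_congr rfl fun k _ => ?_
    rw [map_mul, map_pow, aeval_X, aeval_C, ← Algebra.smul_def, Matrix.smul_apply, innerShift_pow,
      Matrix.kronecker_apply, Matrix.transpose_apply, superdiag_pow_apply, smul_eq_mul]
    ring
  rw [Matrix.sub_apply, h1, h2]
  simp only [matN, blockA0, blockA, Matrix.of_apply, Matrix.smul_apply, smul_eq_mul]
  rcases eq_or_ne x y with rfl | hxy
  · simp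
  · simp only [hxy, if_false, Matrix.one_apply_ne hxy]
    split_ifs <;> simp

open Polynomial in
theorem commute_aeval_aeval {A : Type*} [Ring A] [Algebra ℂ A] {u v : A} (h : Commute u v)
    (P Q : ℂ[X]) : Commute (aeval u P) (aeval v Q) := by
  have h1 : Commute u (aeval v Q) := by
    refine Polynomial.induction_on' Q (fun a b ha hb => ?_) fun k c => ?_
    · rw [map_add]; exact ha.add_right hb
    · rw [aeval_monomial]; exact (Algebra.commute_algebraMap_right c u).mul_right (h.pow_right k)
  refine Polynomial.induction_on' P (fun a b ha hb => ?_) fun k c => ?_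
  · rw [map_add]; exact ha.add_left hb
  · rw [aeval_monomial]; exact (Algebra.commute_algebraMap_left c _).mul_left (h1.pow_left k)

theorem matN_pow_eq_zero (n : ℕ) : matN n ^ (2 * n - 1) = 0 := by
  rw [matN_eq, sub_eq_add_neg]
  refine Commute.add_pow_eq_zero_of_add_le_succ_of_pow_eq_zero (m := n) (n := n)
    (commute_aeval_aeval (commute_outerShift_innerShift n) _ _).neg_right
    (aeval_logPoly_pow_eq_zero (outerShift_pow_eq_zero n)) ?_ (by omega)
  rw [neg_pow, aeval_logPoly_pow_eq_zero (innerShift_pow_eq_zero n), mul_zero]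

theorem one_add_innerShift_mul_exp_matN {n : ℕ} (hn : 1 ≤ n) :
    (1 + innerShift n) * IsNilpotent.exp (matN n) = 1 + outerShift n := by
  have hU := aeval_logPoly_pow_eq_zero (outerShift_pow_eq_zero n)
  have hV := aeval_logPoly_pow_eq_zero (innerShift_pow_eq_zero n)
  have hVn : IsNilpotent (Polynomial.aeval (innerShift n) (logPoly n)) := ⟨n, hV⟩
  rw [matN_eq, sub_eq_add_neg, add_comm (Polynomial.aeval _ _),
    IsNilpotent.exp_add_of_commute
      (commute_aeval_aeval (commute_outerShift_innerShift n).symm _ _).neg_left hVn.neg ⟨n, hU⟩,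
    ← exp_aeval_logPoly hn (innerShift_pow_eq_zero n), ← mul_assoc,
    IsNilpotent.exp_mul_exp_neg_self hVn, one_mul, exp_aeval_logPoly hn (outerShift_pow_eq_zero n)]

/-! ### The polynomials of the operators `∇_{k,l}` -/

theorem isNilpotent_smul_matN (n : ℕ) (P : ℂ[X]) :
    IsNilpotent (P • (matN n).map Polynomial.C) := by
  refine ⟨2 * n - 1, ?_⟩
  have h : (matN n).map Polynomial.C = Polynomial.C.mapMatrix (matN n) := rfl
  rw [smul_pow, h, ← map_pow, matN_pow_eq_zero, map_zero, smul_zero]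

/-- Serves for two substitutions: `X ↦ X + 1`, which gives the recurrence, and `X ↦ 0`, which gives
the initial values. -/
theorem map_expN (n : ℕ) (f : ℂ[X] →+* ℂ[X]) (hf : ∀ c, f (Polynomial.C c) = Polynomial.C c) :
    (expN n).map f = IsNilpotent.exp (f Polynomial.X • (matN n).map Polynomial.C) := by
  have h := IsNilpotent.map_exp (isNilpotent_smul_matN n Polynomial.X) f.mapMatrix
  refine h.trans (congrArg _ ?_)
  ext1 x y
  rw [RingHom.mapMatrix_apply, Matrix.map_apply, Matrix.smul_apply, Matrix.smul_apply,
    Matrix.map_apply, smul_eq_mul, smul_eq_mul, map_mul, hf]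

theorem expN_comp {n : ℕ} (hn : 1 ≤ n) :
    (1 + innerShift n).map Polynomial.C *
        (expN n).map (Polynomial.compRingHom (Polynomial.X + 1)) =
      (1 + outerShift n).map Polynomial.C * expN n := by
  have hN := isNilpotent_smul_matN n 1
  have hexp := IsNilpotent.map_exp (⟨_, matN_pow_eq_zero n⟩ : IsNilpotent (matN n))
    (Polynomial.C : ℂ →+* ℂ[X]).mapMatrix
  have hmul : ∀ a b : Matrix (Fin n × Fin n) (Fin n × Fin n) ℂ,
      (a * b).map Polynomial.C = a.map Polynomial.C * b.map Polynomial.C := fun a b =>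
    map_mul (Polynomial.C : ℂ →+* ℂ[X]).mapMatrix a b
  rw [map_expN n _ (by simp), Polynomial.coe_compRingHom_apply, Polynomial.X_comp,
    add_comm Polynomial.X, add_smul, IsNilpotent.exp_add_of_commute _ hN (isNilpotent_smul_matN n _),
    ← mul_assoc,
    ← one_add_innerShift_mul_exp_matN hn, hmul]
  · congr 2
    rw [one_smul]
    exact hexp.symm
  · rw [one_smul]
    exact (Commute.refl _).smul_right _

/-- The polynomial of `∇_{k,l}`, extended by zero to all natural numbers `k` and `l`. -/
noncomputable def nablaCoeff (n k l : ℕ) : ℂ[X] :=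
  if h : k < n ∧ l < n then nablaPoly ⟨k, h.1⟩ ⟨l, h.2⟩ else 0

theorem nablaCoeff_coe {n : ℕ} (k l : Fin n) : nablaCoeff n k l = nablaPoly k l :=
  dif_pos ⟨k.2, l.2⟩

theorem eval_zero_nablaCoeff {n k l : ℕ} (hk : k < n) (hl : l < n) :
    (nablaCoeff n k l).eval 0 = if k = 0 ∧ l = 0 then 1 else 0 := by
  have h := map_expN n (Polynomial.C.comp (Polynomial.evalRingHom 0)) (by simp)
  rw [RingHom.comp_apply, Polynomial.coe_evalRingHom, Polynomial.eval_X, map_zero, zero_smul,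
    IsNilpotent.exp_zero] at h
  have h' := congrFun (congrFun h (⟨n - k - 1, by omega⟩, ⟨l, hl⟩))
    (⟨n - 1, by omega⟩, ⟨0, by omega⟩)
  rw [Matrix.map_apply, RingHom.comp_apply, Matrix.one_apply] at h'
  rw [nablaCoeff, dif_pos ⟨hk, hl⟩]
  refine Polynomial.C_injective (h'.trans ?_)
  simp only [Prod.mk.injEq, Fin.mk.injEq]
  rw [apply_ite Polynomial.C, map_one, map_zero]
  refine if_congr (and_congr_left fun _ => by omega) rfl rfl

theorem outerShift_mul_apply {n : ℕ} {ι : Type*} (M : Matrix (Fin n × Fin n) ι ℂ[X])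
    (x p : Fin n) (c : ι) : ((outerShift n).map Polynomial.C * M) (x, p) c =
      if h : (x : ℕ) + 1 < n then M (⟨x + 1, h⟩, p) c else 0 := by
  have hterm : ∀ y q : Fin n, (outerShift n).map Polynomial.C (x, p) (y, q) =
      if (x : ℕ) + 1 = y ∧ p = q then (1 : ℂ[X]) else 0 := fun y q => by
    rw [Matrix.map_apply, outerShift, Matrix.kronecker_apply, superdiag_apply, Matrix.one_apply]
    split_ifs <;> simp_all
  rw [Matrix.mul_apply, Fintype.sum_prod_type]
  simp only [hterm]
  split_ifs with h
  · rw [Finset.sum_eq_single ⟨x + 1, h⟩, Finset.sum_eq_single p]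
    · simp
    · intro q _ hq
      rw [if_neg fun h' => hq h'.2.symm, zero_mul]
    · simp
    · intro y _ hy
      exact Finset.sum_eq_zero fun q _ => by rw [if_neg fun h' => hy (Fin.ext h'.1.symm), zero_mul]
    · simp
  · exact Finset.sum_eq_zero fun y _ => Finset.sum_eq_zero fun q _ => by
      rw [if_neg (by omega), zero_mul]

theorem innerShift_mul_apply {n : ℕ} {ι : Type*} (M : Matrix (Fin n × Fin n) ι ℂ[X])
    (x p : Fin n) (c : ι) : ((innerShift n).map Polynomial.C * M) (x, p) c =
      if (p : ℕ) = 0 then 0 else M (x, ⟨p - 1, by omega⟩) c := by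
  have hterm : ∀ y q : Fin n, (innerShift n).map Polynomial.C (x, p) (y, q) =
      if x = y ∧ (q : ℕ) + 1 = p then (1 : ℂ[X]) else 0 := fun y q => by
    rw [Matrix.map_apply, innerShift, Matrix.kronecker_apply, Matrix.transpose_apply,
      superdiag_apply, Matrix.one_apply]
    split_ifs <;> simp_all
  rw [Matrix.mul_apply, Fintype.sum_prod_type]
  simp only [hterm]
  split_ifs with h
  · exact Finset.sum_eq_zero fun y _ => Finset.sum_eq_zero fun q _ => by
      rw [if_neg (by omega), zero_mul]
  · rw [Finset.sum_eq_single x, Finset.sum_eq_single ⟨p - 1, by omega⟩]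
    · rw [if_pos ⟨rfl, by simp only; omega⟩, one_mul]
    · intro q _ hq
      rw [if_neg fun h' => hq (Fin.ext (by simp only; omega)), zero_mul]
    · simp
    · intro y _ hy
      exact Finset.sum_eq_zero fun q _ => by rw [if_neg fun h' => hy h'.1.symm, zero_mul]
    · simp

/-- The relation between `∇_{k,l}` and its translate by one. -/
theorem nablaCoeff_comp {n k l : ℕ} (hk : k < n) (hl : l < n) :
    (nablaCoeff n k l).comp (Polynomial.X + 1) +
        (if l = 0 then 0 else (nablaCoeff n k (l - 1)).comp (Polynomial.X + 1)) =
      nablaCoeff n k l + if k = 0 then 0 else nablaCoeff n (k - 1) l := by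
  -- In the row `(n-k-1, l)`, the block shift raises the block index, hence replaces `k` by `k-1`,
  -- and the inner shift replaces `l` by `l-1`.
  have h := congrFun (congrFun (expN_comp (n := n) (by omega)) (⟨n - k - 1, by omega⟩, ⟨l, hl⟩))
    (⟨n - 1, by omega⟩, ⟨0, by omega⟩)
  have hone : ∀ a : Matrix (Fin n × Fin n) (Fin n × Fin n) ℂ,
      (1 + a).map Polynomial.C = 1 + a.map Polynomial.C := fun a => by
    have := map_add (Polynomial.C : ℂ →+* ℂ[X]).mapMatrix 1 a
    rwa [map_one] at this
  rw [hone, hone, add_mul, add_mul, one_mul, one_mul, Matrix.add_apply, Matrix.add_apply,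
    outerShift_mul_apply, innerShift_mul_apply, Matrix.map_apply, Matrix.map_apply] at h
  have hcoeff : ∀ {k' l' : ℕ} (x p : Fin n), k' < n → (x : ℕ) = n - k' - 1 → (p : ℕ) = l' →
      nablaCoeff n k' l' = expN n (x, p) (⟨n - 1, by omega⟩, ⟨0, by omega⟩) := by
    intro k' l' x p hk' hx hp
    rw [nablaCoeff, dif_pos ⟨hk', hp ▸ p.2⟩, nablaPoly]
    congr 2
    · exact Fin.ext hx.symm
    · exact Fin.ext hp.symm
  convert h using 2
  · rw [hcoeff ⟨n - k - 1, by omega⟩ ⟨l, hl⟩ hk rfl rfl]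
    rfl
  · refine if_congr Iff.rfl rfl ?_
    rw [hcoeff ⟨n - k - 1, by omega⟩ ⟨l - 1, by omega⟩ hk rfl rfl]
    rfl
  · rw [hcoeff ⟨n - k - 1, by omega⟩ ⟨l, hl⟩ hk rfl rfl]
  · by_cases hk0 : k = 0
    · rw [if_pos hk0, dif_neg (by simp only; omega)]
    · rw [if_neg hk0, dif_pos (by simp only; omega)]
      exact hcoeff _ _ (by omega) (by simp only; omega) rfl

/-! ### The operator `∇` -/

theorem nabla_const_mul (c : ℂ) (f : ℂ → ℂ) : nabla (fun u => c * f u) = fun u => c * nabla f u := by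
  funext u
  rw [nabla, nabla, deriv_const_mul_field, mul_left_comm]

theorem nabla_iterate_const_mul (c : ℂ) (f : ℂ → ℂ) (r : ℕ) :
    nabla^[r] (fun u => c * f u) = fun u => c * nabla^[r] f u := by
  induction r generalizing f with
  | zero => rfl
  | succ r ih => rw [Function.iterate_succ_apply, nabla_const_mul, ih, Function.iterate_succ_apply]

theorem nabla_iterate_eq (f : ℂ → ℂ) (r : ℕ) :
    nabla^[r] f = fun u => (-(1 / (2 * Real.pi * Complex.I))) ^ r * iteratedDeriv r f u := by
  induction r with
  | zero => simp
  | succ r ih =>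
    rw [Function.iterate_succ_apply', ih, nabla_const_mul]
    funext u
    rw [iteratedDeriv_succ, pow_succ, mul_assoc (_ ^ r)]
    rfl

theorem nabla_const (c : ℂ) : nabla (fun _ => c) = 0 := by
  funext u
  simp [nabla]

theorem nabla_congr {Ω : Set ℂ} (hΩ : IsOpen Ω) {f g : ℂ → ℂ}
    (h : Set.EqOn f g Ω) : Set.EqOn (nabla f) (nabla g) Ω := fun u hu => by
  rw [nabla, nabla, (h.eventuallyEq_of_mem (hΩ.mem_nhds hu)).deriv_eq]

theorem nabla_iterate_congr {Ω : Set ℂ} (hΩ : IsOpen Ω) {f g : ℂ → ℂ}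
    (h : Set.EqOn f g Ω) (r : ℕ) :
    Set.EqOn (nabla^[r] f) (nabla^[r] g) Ω := by
  induction r generalizing f g with
  | zero => exact h
  | succ r ih => exact ih (nabla_congr hΩ h)

theorem differentiableOn_nabla {Ω : Set ℂ} (hΩ : IsOpen Ω) {f : ℂ → ℂ}
    (hf : DifferentiableOn ℂ f Ω) : DifferentiableOn ℂ (nabla f) Ω :=
  (hf.deriv hΩ).const_mul _

theorem nabla_add {Ω : Set ℂ} (hΩ : IsOpen Ω) {f g : ℂ → ℂ}
    (hf : DifferentiableOn ℂ f Ω) (hg : DifferentiableOn ℂ g Ω) :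
    Set.EqOn (nabla (f + g)) (nabla f + nabla g) Ω := fun u hu => by
  rw [Pi.add_apply, nabla, nabla, nabla, deriv_add (hf.differentiableAt (hΩ.mem_nhds hu))
    (hg.differentiableAt (hΩ.mem_nhds hu)), mul_add]

theorem nabla_mul {Ω : Set ℂ} (hΩ : IsOpen Ω) {f g : ℂ → ℂ}
    (hf : DifferentiableOn ℂ f Ω) (hg : DifferentiableOn ℂ g Ω) :
    Set.EqOn (nabla (f * g)) (nabla f * g + f * nabla g) Ω := fun u hu => by
  simp only [Pi.add_apply, Pi.mul_apply, nabla]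
  rw [deriv_mul (hf.differentiableAt (hΩ.mem_nhds hu)) (hg.differentiableAt (hΩ.mem_nhds hu))]
  ring

theorem nabla_iterate_add {Ω : Set ℂ} (hΩ : IsOpen Ω) {f g : ℂ → ℂ}
    (hf : DifferentiableOn ℂ f Ω) (hg : DifferentiableOn ℂ g Ω) (r : ℕ) :
    Set.EqOn (nabla^[r] (f + g)) (nabla^[r] f + nabla^[r] g) Ω := by
  induction r generalizing f g with
  | zero => exact fun _ _ => rfl
  | succ r ih =>
    exact (nabla_iterate_congr hΩ (nabla_add hΩ hf hg) r).trans
      (ih (differentiableOn_nabla hΩ hf) (differentiableOn_nabla hΩ hg))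

theorem polyNabla_add (P Q : ℂ[X]) (f : ℂ → ℂ) (u : ℂ) :
    polyNabla (P + Q) f u = polyNabla P f u + polyNabla Q f u :=
  Polynomial.sum_add_index P Q _ (fun _ => zero_mul _) fun _ _ _ => add_mul _ _ _

theorem polyNabla_zero (f : ℂ → ℂ) (u : ℂ) : polyNabla 0 f u = 0 := Polynomial.sum_zero_index _

theorem polyNabla_monomial (r : ℕ) (c : ℂ) (f : ℂ → ℂ) (u : ℂ) :
    polyNabla (Polynomial.monomial r c) f u = c * nabla^[r] f u :=
  Polynomial.sum_monomial_index _ _ (zero_mul _)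

theorem polyNabla_C_mul (c : ℂ) (P : ℂ[X]) (f : ℂ → ℂ) (u : ℂ) :
    polyNabla (Polynomial.C c * P) f u = c * polyNabla P f u := by
  induction P using Polynomial.induction_on' with
  | add P Q hP hQ => rw [mul_add, polyNabla_add, hP, hQ, polyNabla_add, mul_add]
  | monomial r a => rw [Polynomial.C_mul_monomial, polyNabla_monomial, polyNabla_monomial, mul_assoc]

theorem polyNabla_mul_X (P : ℂ[X]) (f : ℂ → ℂ) (u : ℂ) :
    polyNabla (P * Polynomial.X) f u = polyNabla P (nabla f) u := by
  induction P using Polynomial.induction_on' with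
  | add P Q hP hQ => rw [add_mul, polyNabla_add, hP, hQ, polyNabla_add]
  | monomial r a =>
    rw [Polynomial.monomial_mul_X, polyNabla_monomial, polyNabla_monomial,
      Function.iterate_succ_apply]

theorem polyNabla_const_mul (P : ℂ[X]) (c : ℂ) (f : ℂ → ℂ) (u : ℂ) :
    polyNabla P (fun u => c * f u) u = c * polyNabla P f u := by
  induction P using Polynomial.induction_on' with
  | add P Q hP hQ => rw [polyNabla_add, hP, hQ, polyNabla_add, mul_add]
  | monomial r a => rw [polyNabla_monomial, polyNabla_monomial, nabla_iterate_const_mul,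
      mul_left_comm]

theorem polyNabla_one (P : ℂ[X]) (u : ℂ) : polyNabla P (fun _ => 1) u = P.eval 0 := by
  induction P using Polynomial.induction_on' with
  | add P Q hP hQ => rw [polyNabla_add, hP, hQ, Polynomial.eval_add]
  | monomial r a =>
    rw [polyNabla_monomial, Polynomial.eval_monomial]
    cases r with
    | zero => simp
    | succ r =>
      have := nabla_iterate_const_mul 0 0 r
      simp only [zero_mul] at this
      rw [Function.iterate_succ_apply, nabla_const, zero_pow r.succ_ne_zero]
      exact congrArg _ (congrFun this u)

theorem polyNabla_congr {Ω : Set ℂ} (hΩ : IsOpen Ω) {u : ℂ}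
    (hu : u ∈ Ω) (P : ℂ[X]) {f g : ℂ → ℂ} (h : Set.EqOn f g Ω) : polyNabla P f u = polyNabla P g u := by
  induction P using Polynomial.induction_on' with
  | add P Q hP hQ => rw [polyNabla_add, hP, hQ, polyNabla_add]
  | monomial r a =>
    rw [polyNabla_monomial, polyNabla_monomial, nabla_iterate_congr hΩ h r hu]

theorem polyNabla_fun_add {Ω : Set ℂ} (hΩ : IsOpen Ω) {u : ℂ}
    (hu : u ∈ Ω) (P : ℂ[X]) {f g : ℂ → ℂ} (hf : DifferentiableOn ℂ f Ω) (hg : DifferentiableOn ℂ g Ω) :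
    polyNabla P (f + g) u = polyNabla P f u + polyNabla P g u := by
  induction P using Polynomial.induction_on' with
  | add P Q hP hQ => rw [polyNabla_add, hP, hQ, polyNabla_add, polyNabla_add]; ring
  | monomial r a =>
    rw [polyNabla_monomial, polyNabla_monomial, polyNabla_monomial,
      nabla_iterate_add hΩ hf hg r hu, Pi.add_apply, mul_add]

/-- Multiplication by a fixed vector of `∇` translates `∇` by one. -/
theorem polyNabla_mul_of_nabla_eq_self {Ω : Set ℂ} (hΩ : IsOpen Ω) {u : ℂ}
    (hu : u ∈ Ω) (P : ℂ[X]) {f g : ℂ → ℂ} (hf : DifferentiableOn ℂ f Ω) (hf' : Set.EqOn (nabla f) f Ω)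
    (hg : DifferentiableOn ℂ g Ω) :
    polyNabla P (f * g) u = f u * polyNabla (P.comp (Polynomial.X + 1)) g u := by
  induction P using Polynomial.induction_on' with
  | add P Q hP hQ => rw [polyNabla_add, hP, hQ, Polynomial.add_comp, polyNabla_add, mul_add]
  | monomial r a =>
    rw [polyNabla_monomial, Polynomial.monomial_comp, polyNabla_C_mul, mul_left_comm]
    congr 1
    -- Since `∇f = f`, Leibniz gives `∇(f g) = f (g + ∇g)`; the induction continues with `g + ∇g` in
    -- place of `g`.
    induction r generalizing g with
    | zero =>
      rw [pow_zero, ← Polynomial.monomial_zero_one, polyNabla_monomial, one_mul]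
      rfl
    | succ r ih =>
      have hg' := differentiableOn_nabla hΩ hg
      have hstep : Set.EqOn (nabla (f * g)) (f * (g + nabla g)) Ω := fun w hw => by
        rw [nabla_mul hΩ hf hg hw, Pi.add_apply, Pi.mul_apply, Pi.mul_apply, hf' hw, Pi.mul_apply,
          Pi.add_apply, mul_add]
      rw [Function.iterate_succ_apply, nabla_iterate_congr hΩ hstep r hu, ih (hg.add hg'),
        polyNabla_fun_add hΩ hu _ hg hg', pow_succ, mul_add (_ ^ r), mul_one, polyNabla_add,
        polyNabla_mul_X, add_comm]

/-- Holomorphy in `z` after differentiating in `w`, without two-variable calculus: by Leibniz, `∇`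
sends `f(z+w) g(w)` to a sum of two products of the same shape, with `∇f` or `∇g` in place of `f` or
`g`. -/
theorem differentiable_polyNabla_translate {Ω : Set ℂ} (hΩ : IsOpen Ω) {u : ℂ}
    (hu : u ∈ Ω) (P : ℂ[X]) {f g : ℂ → ℂ} (hf : Differentiable ℂ f)
    (hg : DifferentiableOn ℂ g Ω) :
    Differentiable ℂ fun z => polyNabla P (fun w => f (z + w) * g w) u := by
  induction P using Polynomial.induction_on' with
  | add P Q hP hQ => simp only [polyNabla_add]; exact hP.add hQ
  | monomial r a =>
    simp only [polyNabla_monomial]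
    refine Differentiable.const_mul ?_ a
    induction r generalizing f g with
    | zero => simp only [Function.iterate_zero, id]; fun_prop
    | succ r ih =>
      have hf' : Differentiable ℂ (nabla f) := fun z =>
        (differentiableOn_nabla isOpen_univ hf.differentiableOn).differentiableAt Filter.univ_mem
      have hg' := differentiableOn_nabla hΩ hg
      have hstep : ∀ z, Set.EqOn (nabla fun w => f (z + w) * g w)
          ((fun w => nabla f (z + w) * g w) + fun w => f (z + w) * nabla g w) Ω := fun z w hw => by
        have hft : Differentiable ℂ fun w => f (z + w) := by fun_prop
        refine (nabla_mul hΩ hft.differentiableOn hg hw).trans ?_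
        simp only [Pi.add_apply, Pi.mul_apply]
        rw [nabla, deriv_comp_const_add, ← nabla]
      have hd : ∀ z, DifferentiableOn ℂ (fun w => nabla f (z + w)) Ω := fun z =>
        (show Differentiable ℂ fun w => nabla f (z + w) by fun_prop).differentiableOn
      have hd' : ∀ z, DifferentiableOn ℂ (fun w => f (z + w)) Ω := fun z =>
        (show Differentiable ℂ fun w => f (z + w) by fun_prop).differentiableOn
      have heq : (fun z => nabla^[r + 1] (fun w => f (z + w) * g w) u) = fun z =>
          nabla^[r] (fun w => nabla f (z + w) * g w) u +
            nabla^[r] (fun w => f (z + w) * nabla g w) u := by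
        funext z
        rw [Function.iterate_succ_apply, nabla_iterate_congr hΩ (hstep z) r hu]
        exact nabla_iterate_add hΩ ((hd z).mul hg) ((hd' z).mul hg') r hu
      rw [heq]
      exact (ih hf' hg).add (ih hf hg')

/-! ### Solutions for a Jordan block -/

/-- Reindexing for multiplication by `S`: the top term drops out, in the applications because `Sⁿ =
0`. -/
theorem sum_smul_succ_eq {M : Type*} [AddCommGroup M] [Module ℂ M] {n : ℕ} (c : ℕ → ℂ) (x : ℕ → M)
    (hx : x n = 0) : ∑ l ∈ Finset.range n, c l • x (l + 1) =
      ∑ l ∈ Finset.range n, (if l = 0 then 0 else c (l - 1)) • x l := by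
  have h := Finset.sum_range_succ' (fun l => (if l = 0 then 0 else c (l - 1)) • x l) n
  rw [Finset.sum_range_succ, hx, smul_zero, add_zero] at h
  simpa using h.symm

/-- The matrix `∑ c_{k,l} Sᵏ Z Sˡ`, where `S` is the nilpotent part of the Jordan block. -/
def shiftSum {n : ℕ} (c : ℕ → ℕ → ℂ) (Z : Mat n) : Mat n :=
  ∑ k ∈ Finset.range n, ∑ l ∈ Finset.range n,
    c k l • (superdiag n ^ k * Z * superdiag n ^ l)

theorem shiftSum_mul_jordan {n : ℕ} {c d : ℕ → ℕ → ℂ} (Z : Mat n)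
    (h : ∀ k l, k < n → l < n → d k l + (if l = 0 then 0 else d k (l - 1)) =
      c k l + if k = 0 then 0 else c (k - 1) l) :
    shiftSum d Z * jordan n = jordan n * shiftSum c Z := by
  have h1 : shiftSum d Z * superdiag n = ∑ k ∈ Finset.range n, ∑ l ∈ Finset.range n,
      (if l = 0 then 0 else d k (l - 1)) • (superdiag n ^ k * Z * superdiag n ^ l) := by
    rw [shiftSum, Finset.sum_mul]
    refine Finset.sum_congr rfl fun k _ => ?_
    rw [Finset.sum_mul, ← sum_smul_succ_eq (d k) (fun l => superdiag n ^ k * Z * superdiag n ^ l)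
      (by rw [superdiag_pow_eq_zero, mul_zero])]
    refine Finset.sum_congr rfl fun l _ => ?_
    rw [smul_mul_assoc, mul_assoc _ (superdiag n ^ l), ← pow_succ]
  have h2 : superdiag n * shiftSum c Z = ∑ k ∈ Finset.range n, ∑ l ∈ Finset.range n,
      (if k = 0 then 0 else c (k - 1) l) • (superdiag n ^ k * Z * superdiag n ^ l) := by
    simp only [shiftSum, Finset.mul_sum]
    rw [Finset.sum_comm]
    conv_rhs => rw [Finset.sum_comm]
    refine Finset.sum_congr rfl fun l _ => ?_
    rw [← sum_smul_succ_eq (fun k => c k l) (fun k => superdiag n ^ k * Z * superdiag n ^ l)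
      (by rw [superdiag_pow_eq_zero, zero_mul, zero_mul])]
    refine Finset.sum_congr rfl fun k _ => ?_
    rw [mul_smul_comm, ← mul_assoc, ← mul_assoc, ← pow_succ']
  rw [jordan_eq, mul_add, add_mul, mul_one, one_mul, h1, h2, shiftSum, shiftSum,
    ← Finset.sum_add_distrib, ← Finset.sum_add_distrib]
  refine Finset.sum_congr rfl fun k hk => ?_
  rw [← Finset.sum_add_distrib, ← Finset.sum_add_distrib]
  refine Finset.sum_congr rfl fun l hl => ?_
  rw [← add_smul, ← add_smul, h k l (Finset.mem_range.1 hk) (Finset.mem_range.1 hl)]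

/-- The scalar solution, normalized to take the value one at `y`. -/
noncomputable def scalarSol (τ y z u : ℂ) : ℂ := thetaShift τ (z + u - y) * (thetaShift τ u)⁻¹

theorem scalarSol_add_tau (τ y z u : ℂ) :
    scalarSol τ y (z + τ) u = factor τ u y z * scalarSol τ y z u := by
  rw [scalarSol, scalarSol, show z + τ + u - y = z + u - y + τ by ring, thetaShift_add_tau, factor,
    ← mul_assoc]
  congr 2
  rw [neg_mul, ← Complex.exp_add]
  ring_nf

/-- This is what fixes the constant `-1/(2πi)` in `∇`: the multiplier becomes an eigenvector with
eigenvalue one. -/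
theorem nabla_factor (τ y z : ℂ) : nabla (fun u => factor τ u y z) = fun u => factor τ u y z := by
  funext u
  have h : HasDerivAt (fun u => factor τ u y z)
      (-(Complex.exp (-2 * Real.pi * Complex.I * (z + u - y + τ)) *
        (-2 * Real.pi * Complex.I * 1))) u :=
    ((((((hasDerivAt_id u).const_add z).sub_const y).add_const τ).const_mul
      (-2 * Real.pi * Complex.I)).cexp).neg
  rw [nabla, h.deriv, factor]
  have := Complex.two_pi_I_ne_zero
  field_simp

theorem isOpen_thetaShift_ne_zero {τ : ℂ} (hτ : 0 < τ.im) : IsOpen {u | thetaShift τ u ≠ 0} :=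
  isOpen_ne_fun (differentiable_thetaShift hτ).continuous continuous_const

theorem differentiableOn_scalarSol {τ : ℂ} (hτ : 0 < τ.im) (y z : ℂ) :
    DifferentiableOn ℂ (scalarSol τ y z) {u | thetaShift τ u ≠ 0} := by
  have h := differentiable_thetaShift hτ
  exact DifferentiableOn.mul
    (show Differentiable ℂ fun u => thetaShift τ (z + u - y) by fun_prop).differentiableOn
    (h.differentiableOn.inv fun u hu => hu)

/-- The coefficients of the solution with value `Z` at `y` in the products `Sᵏ Z Sˡ`. -/
noncomputable def solCoeff (n : ℕ) (τ v y z : ℂ) (k l : ℕ) : ℂ :=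
  polyNabla (nablaCoeff n k l) (scalarSol τ y z) v

theorem shiftSum_mem_Sol {τ : ℂ} (hτ : 0 < τ.im) (n : ℕ) {v : ℂ} (y : ℂ) (hv : v ∉ lattice τ)
    (Z : Mat n) : (fun z => shiftSum (solCoeff n τ v y z) Z) ∈ Sol (jordan n) τ v y := by
  have hΩ := isOpen_thetaShift_ne_zero hτ
  have hvΩ : v ∈ {u | thetaShift τ u ≠ 0} := thetaShift_ne_zero hτ hv
  have hθ := differentiable_thetaShift hτ
  refine ⟨fun i j => ?_, fun z => ?_, fun z => ?_⟩
  · simp only [shiftSum, Matrix.sum_apply, Matrix.smul_apply, smul_eq_mul]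
    refine Differentiable.fun_sum fun k _ => Differentiable.fun_sum fun l _ =>
      Differentiable.mul_const ?_ _
    have := differentiable_polyNabla_translate hΩ hvΩ (nablaCoeff n k l)
      (f := fun w => thetaShift τ (w - y)) (g := fun u => (thetaShift τ u)⁻¹) (by fun_prop)
      (hθ.differentiableOn.inv fun u hu => hu)
    exact this
  · have : scalarSol τ y (z + 1) = scalarSol τ y z := by
      funext u
      rw [scalarSol, scalarSol, show z + 1 + u - y = z + u - y + 1 by ring, thetaShift_add_one]
    have hc : solCoeff n τ v y (z + 1) = solCoeff n τ v y z := by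
      funext k l
      rw [solCoeff, this, solCoeff]
    simp only [hc]
  · have hstep : ∀ k l, solCoeff n τ v y (z + τ) k l = factor τ v y z *
        polyNabla ((nablaCoeff n k l).comp (Polynomial.X + 1)) (scalarSol τ y z) v := fun k l => by
      have h1 : scalarSol τ y (z + τ) = (fun u => factor τ u y z) * scalarSol τ y z :=
        funext (scalarSol_add_tau τ y z)
      rw [solCoeff, h1, polyNabla_mul_of_nabla_eq_self hΩ hvΩ]
      · refine Differentiable.differentiableOn ?_
        unfold factor
        fun_prop
      · rw [nabla_factor]
        exact Set.eqOn_refl _ _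
      · exact differentiableOn_scalarSol hτ y z
    have hsmul : shiftSum (solCoeff n τ v y (z + τ)) Z = factor τ v y z • shiftSum (fun k l =>
        polyNabla ((nablaCoeff n k l).comp (Polynomial.X + 1)) (scalarSol τ y z) v) Z := by
      simp only [shiftSum, hstep, Finset.smul_sum, smul_smul]
    dsimp only
    rw [hsmul, smul_mul_assoc]
    refine congrArg _ (shiftSum_mul_jordan Z fun k l hk hl => ?_)
    have h := congrArg (fun P => polyNabla P (scalarSol τ y z) v) (nablaCoeff_comp hk hl)
    simp only [polyNabla_add] at h
    have hite : ∀ (p : Prop) [Decidable p] (P : ℂ[X]),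
        polyNabla (if p then 0 else P) (scalarSol τ y z) v =
          if p then 0 else polyNabla P (scalarSol τ y z) v := fun p _ P => by
      split_ifs
      · rw [polyNabla_zero]
      · rfl
    rwa [hite, hite] at h

theorem shiftSum_solCoeff_self {τ : ℂ} (hτ : 0 < τ.im) (n : ℕ) {v : ℂ} (y : ℂ)
    (hv : v ∉ lattice τ) (Z : Mat n) : shiftSum (solCoeff n τ v y y) Z = Z := by
  have hcoeff : ∀ k l, solCoeff n τ v y y k l = (nablaCoeff n k l).eval 0 := fun k l => by
    -- At `z = y` the scalar solution equals `1` only where the theta denominator is nonzero; this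
    -- open set contains `v`, so the derivatives at `v` are those of the constant.
    rw [solCoeff, polyNabla_congr (isOpen_thetaShift_ne_zero hτ)
      (show v ∈ {u | thetaShift τ u ≠ 0} from thetaShift_ne_zero hτ hv) _ (g := fun _ => 1),
      polyNabla_one]
    intro u hu
    simp only [scalarSol]
    rw [add_sub_cancel_left, mul_inv_cancel₀ hu]
  rcases n.eq_zero_or_pos with rfl | hn
  · exact Subsingleton.elim _ _
  · rw [shiftSum, Finset.sum_eq_single 0, Finset.sum_eq_single 0]
    · rw [hcoeff, eval_zero_nablaCoeff hn hn]
      simp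
    · intro l hl hl0
      rw [hcoeff, eval_zero_nablaCoeff hn (Finset.mem_range.1 hl), if_neg (by simp [hl0]), zero_smul]
    · intro h
      exact absurd (Finset.mem_range.2 hn) h
    · intro k hk hk0
      refine Finset.sum_eq_zero fun l hl => ?_
      rw [hcoeff, eval_zero_nablaCoeff (Finset.mem_range.1 hk) (Finset.mem_range.1 hl),
        if_neg (by simp [hk0]), zero_smul]
    · intro h
      exact absurd (Finset.mem_range.2 hn) h

/-- The function `scalarSol` spans the scalar solutions and takes the value `1` at `y`, so the
multiple in question is `f y = 0`. -/
theorem eq_zero_of_scalar_solution {τ : ℂ} (hτ : 0 < τ.im) {v y : ℂ} (hv : v ∉ lattice τ)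
    {f : ℂ → ℂ} (hd : Differentiable ℂ f) (h1 : ∀ z, f (z + 1) = f z)
    (hq : ∀ z, f (z + τ) = factor τ v y z * f z) (hy : f y = 0) (z : ℂ) : f z = 0 := by
  have hfac : ∀ z, factor τ v y z = -Complex.exp (-2 * Real.pi * Complex.I * (v - y + τ)) *
      Complex.exp (-2 * Real.pi * Complex.I * z) := fun z => by
    rw [factor, neg_mul (Complex.exp _), ← Complex.exp_add]
    ring_nf
  have hθ := differentiable_thetaShift hτ
  have hv' := thetaShift_ne_zero hτ hv
  obtain ⟨c, hc⟩ := exists_eq_mul_of_quasiPeriodic (g := fun z => scalarSol τ y z v)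
    (neg_ne_zero.2 (Complex.exp_ne_zero _)) hd h1
    (fun z => by rw [hq, hfac]) (by unfold scalarSol; fun_prop)
    (fun z => by
      simp only [scalarSol]
      rw [show z + 1 + v - y = z + v - y + 1 by ring, thetaShift_add_one])
    (fun z => by rw [scalarSol_add_tau, hfac])
    (fun h => by
      have := congrFun h y
      simp only [scalarSol] at this
      rw [add_sub_cancel_left, mul_inv_cancel₀ hv'] at this
      exact one_ne_zero this)
  have hc0 := hc y
  rw [hy, scalarSol, add_sub_cancel_left, mul_inv_cancel₀ hv', mul_one] at hc0
  rw [hc, ← hc0, zero_mul]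

theorem mul_superdiag_apply {n : ℕ} (M : Mat n) (i j : Fin n) :
    (M * superdiag n) i j = if (j : ℕ) = 0 then 0 else M i ⟨j - 1, by omega⟩ := by
  rw [Matrix.mul_apply]
  simp only [superdiag_apply, mul_ite, mul_one, mul_zero]
  split_ifs with h
  · exact Finset.sum_eq_zero fun q _ => if_neg (by omega)
  · rw [Finset.sum_eq_single ⟨j - 1, by omega⟩]
    · rw [if_pos (by simp only; omega)]
    · intro q _ hq
      exact if_neg fun h' => hq (Fin.ext (by simp only; omega))
    · simp

theorem superdiag_mul_apply {n : ℕ} (M : Mat n) (i j : Fin n) :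
    (superdiag n * M) i j = if h : (i : ℕ) + 1 < n then M ⟨i + 1, h⟩ j else 0 := by
  rw [Matrix.mul_apply]
  simp only [superdiag_apply, ite_mul, one_mul, zero_mul]
  split_ifs with h
  · rw [Finset.sum_eq_single ⟨i + 1, h⟩]
    · rw [if_pos rfl]
    · intro q _ hq
      exact if_neg fun h' => hq (Fin.ext h'.symm)
    · simp
  · exact Finset.sum_eq_zero fun q _ => if_neg (by omega)

theorem eq_zero_of_mem_Sol {τ : ℂ} (hτ : 0 < τ.im) {n : ℕ} {v y : ℂ} (hv : v ∉ lattice τ)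
    {Φ : ℂ → Mat n} (hΦ : Φ ∈ Sol (jordan n) τ v y) (hy : Φ y = 0) : Φ = 0 := by
  obtain ⟨hd, h1, hq⟩ := hΦ
  -- The equation for the entry `(i, j)` involves only its left and lower neighbours besides itself.
  -- Induction on `j + (n - i)` starts at the lower left corner and leaves a scalar equation each
  -- time.
  have key : ∀ d : ℕ, ∀ i j : Fin n, (j : ℕ) + (n - i) = d → ∀ z, Φ z i j = 0 := by
    intro d
    induction d using Nat.strong_induction_on with
    | _ d ih =>
      intro i j hij
      refine eq_zero_of_scalar_solution hτ hv (y := y) (hd i j) (fun z => by rw [h1])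
        (fun z => ?_) (by rw [hy, Matrix.zero_apply])
      have h := congrFun (congrFun (hq z) i) j
      rw [jordan_eq, mul_add, mul_one, add_mul, one_mul, Matrix.add_apply, Matrix.smul_apply,
        Matrix.add_apply, mul_superdiag_apply, superdiag_mul_apply, smul_eq_mul] at h
      have hl : (if (j : ℕ) = 0 then 0 else Φ (z + τ) i ⟨j - 1, by omega⟩) = 0 := by
        split_ifs with hj
        · rfl
        · exact ih (j - 1 + (n - i)) (by omega) _ _ rfl _
      have hr : (if h : (i : ℕ) + 1 < n then Φ z ⟨i + 1, h⟩ j else 0) = 0 := by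
        split_ifs with hi
        · exact ih (j + (n - (i + 1))) (by omega) _ _ rfl _
        · rfl
      rwa [hl, hr, add_zero, add_zero] at h
  funext z
  ext i j
  exact key _ i j rfl z

theorem bijective_res_jordan {τ : ℂ} (hτ : 0 < τ.im) (n : ℕ) {v : ℂ} (y : ℂ) (hv : v ∉ lattice τ) :
    Function.Bijective (res (jordan n) τ v y) := by
  refine ⟨(injective_iff_map_eq_zero _).2 fun Φ hΦ => ?_, fun Z => ?_⟩
  · exact Subtype.ext (eq_zero_of_mem_Sol hτ hv Φ.2 hΦ)
  · exact ⟨⟨_, shiftSum_mem_Sol hτ n y hv Z⟩, shiftSum_solCoeff_self hτ n y hv Z⟩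

theorem rTilde_jordan_apply {τ : ℂ} (hτ : 0 < τ.im) (n : ℕ) {v₁ v₂ : ℂ} (y₁ y₂ : ℂ)
    (hv : v₁ - v₂ ∉ lattice τ) (Z : Mat n) :
    rTilde (jordan n) τ v₁ v₂ y₁ y₂ Z = (1 / thetaShift τ (y₂ - y₁)) •
      shiftSum (solCoeff n τ (v₁ - v₂) y₁ y₂) Z := by
  have hb := bijective_res_jordan hτ n y₁ hv
  have hinv : (LinearEquiv.ofBijective (res (jordan n) τ (v₁ - v₂) y₁) hb).symm Z =
      ⟨_, shiftSum_mem_Sol hτ n y₁ hv Z⟩ := by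
    rw [LinearEquiv.symm_apply_eq]
    exact (shiftSum_solCoeff_self hτ n y₁ hv Z).symm
  rw [rTilde, dif_pos hb, LinearMap.comp_apply, LinearEquiv.coe_coe, hinv]
  rfl

/-! ### The tensor -/

theorem e_apply (n a b : ℕ) (p q : Fin n) :
    e n a b p q = if (p : ℕ) + 1 = a ∧ (q : ℕ) + 1 = b then 1 else 0 := rfl

theorem e_eq_single {n : ℕ} (p q : Fin n) {a b : ℕ} (ha : a = p + 1) (hb : b = q + 1) :
    e n a b = Matrix.single p q 1 := by
  ext i j
  rw [e_apply, Matrix.single_apply, ha, hb]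
  exact if_congr (by simp only [Fin.ext_iff]; omega) rfl rfl

theorem superdiag_pow_mul_mul_apply {n : ℕ} (Z : Mat n) (k l : ℕ) (a b : Fin n) :
    (superdiag n ^ k * Z * superdiag n ^ l) a b =
      if h : (a : ℕ) + k < n ∧ l ≤ b then Z ⟨a + k, h.1⟩ ⟨b - l, by omega⟩ else 0 := by
  rw [Matrix.mul_apply]
  simp only [Matrix.mul_apply, superdiag_pow_apply, ite_mul, one_mul, zero_mul, mul_ite, mul_one,
    mul_zero]
  split_ifs with h
  · rw [Finset.sum_eq_single ⟨b - l, by omega⟩, Finset.sum_eq_single ⟨a + k, h.1⟩]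
    · rw [if_pos (by simp only; omega), if_pos rfl]
    · intro p _ hp
      exact if_neg fun h' => hp (Fin.ext h'.symm)
    · simp
    · intro q _ hq
      exact if_neg fun h' => hq (Fin.ext (by simp only; omega))
    · simp
  · refine Finset.sum_eq_zero fun q _ => ?_
    split_ifs with hq
    · exact Finset.sum_eq_zero fun p _ => if_neg (by omega)
    · rfl

/-- The tensor `e_{i,j+k} ⊗ e_{j,i+l}` places the entry `Z_{j+k,i}` at position `(j, i+l)`; the
ranges of `i` and `j` keep all indices within `1, …, n`. -/
theorem can_sum_e {n : ℕ} (k l : ℕ) (Z : Mat n) :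
    can n (∑ i ∈ Finset.Icc 1 (n - l), ∑ j ∈ Finset.Icc 1 (n - k),
      e n i (j + k) ⊗ₜ[ℂ] e n j (i + l)) Z = superdiag n ^ k * Z * superdiag n ^ l := by
  ext a b
  simp only [map_sum, LinearMap.sum_apply, can_tmul, Matrix.sum_apply, Matrix.smul_apply,
    smul_eq_mul, superdiag_pow_mul_mul_apply, e_apply n _ _ a b]
  split_ifs with h
  · rw [Finset.sum_eq_single ((b : ℕ) + 1 - l), Finset.sum_eq_single ((a : ℕ) + 1)]
    · rw [e_eq_single (n := n) ⟨b - l, by omega⟩ ⟨a + k, h.1⟩ (by simp only; omega)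
        (by simp only; omega), Matrix.trace_single_mul, if_pos (by omega)]
      simp
    · intro j _ hj
      rw [if_neg (by omega), mul_zero]
    · intro h'
      exact absurd (Finset.mem_Icc.2 (by omega)) h'
    · intro i _ hi
      exact Finset.sum_eq_zero fun j _ => by rw [if_neg (by omega), mul_zero]
    · intro h'
      exact absurd (Finset.mem_Icc.2 (by omega)) h'
  · refine Finset.sum_eq_zero fun i hi => Finset.sum_eq_zero fun j hj => ?_
    rw [Finset.mem_Icc] at hi hj
    rw [if_neg (by omega), mul_zero]

theorem rTensor_jordan {τ : ℂ} (hτ : 0 < τ.im) (n : ℕ) {v₁ v₂ y₁ y₂ : ℂ}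
    (hv : v₁ - v₂ ∉ lattice τ) (hy : y₂ - y₁ ∉ lattice τ) :
    rTensor (jordan n) τ v₁ v₂ y₁ y₂ =
      (Complex.exp (Real.pi * Complex.I * τ / 4) / (Complex.I * deriv (theta τ) 0)) •
        ∑ k : Fin n, ∑ l : Fin n,
          nablaOp k l (fun u => sigma τ u (y₂ - y₁)) (v₁ - v₂) •
            ∑ i ∈ Finset.Icc 1 (n - (l : ℕ)), ∑ j ∈ Finset.Icc 1 (n - (k : ℕ)),
              e n i (j + (k : ℕ)) ⊗ₜ[ℂ] e n j (i + (l : ℕ)) := by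
  have hθy := thetaShift_ne_zero hτ hy
  have hθ0 := deriv_theta_zero_ne_zero hτ
  -- The first factor is inverse to the prefactor of the formula, and the second is the
  -- normalization in `ev`. The equality holds for every `u`, so it may be differentiated.
  have hsig : (fun u => sigma τ u (y₂ - y₁)) = fun u =>
      (Complex.exp (Real.pi * Complex.I * τ / 4) / (Complex.I * deriv (theta τ) 0))⁻¹ *
        (1 / thetaShift τ (y₂ - y₁)) * scalarSol τ y₁ y₂ u := by
    funext u
    rw [sigma_eq_thetaShift hτ, scalarSol, show u + (y₂ - y₁) = y₂ + u - y₁ by ring]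
    have hI := Complex.I_ne_zero
    have he := Complex.exp_ne_zero (Real.pi * Complex.I * τ / 4)
    by_cases hu : thetaShift τ u = 0
    · simp [hu]
    · field_simp
  rw [rTensor, LinearEquiv.symm_apply_eq]
  refine LinearMap.ext fun Z => ?_
  change _ = can n _ Z
  rw [rTilde_jordan_apply hτ n y₁ y₂ hv, shiftSum, Finset.sum_range]
  simp only [Finset.sum_range]
  rw [map_smul, LinearMap.smul_apply, map_sum, LinearMap.sum_apply, Finset.smul_sum,
    Finset.smul_sum]
  refine Finset.sum_congr rfl fun k _ => ?_
  rw [map_sum, LinearMap.sum_apply, Finset.smul_sum, Finset.smul_sum]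
  refine Finset.sum_congr rfl fun l _ => ?_
  rw [map_smul, LinearMap.smul_apply, can_sum_e, smul_smul, smul_smul, hsig, nablaOp,
    polyNabla_const_mul, ← mul_assoc, ← mul_assoc, mul_inv_cancel₀, one_mul, solCoeff,
    nablaCoeff_coe]
  exact div_ne_zero (Complex.exp_ne_zero _) (mul_ne_zero Complex.I_ne_zero hθ0)

/-! ### The case of a `2 × 2` block -/

theorem expN_two_apply (x y : Fin 2 × Fin 2) :
    expN 2 x y = Polynomial.C ((1 : Matrix (Fin 2 × Fin 2) (Fin 2 × Fin 2) ℂ) x y) +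
      Polynomial.X * Polynomial.C (matN 2 x y) +
      Polynomial.X ^ 2 * Polynomial.C (2⁻¹ * (matN 2 * matN 2) x y) := by
  have h : (matN 2).map Polynomial.C = Polynomial.C.mapMatrix (matN 2) := rfl
  -- Here `2n - 1 = 3`, so the exponential stops at the square.
  have hz : ((Polynomial.X : ℂ[X]) • (matN 2).map Polynomial.C) ^ 3 = 0 := by
    rw [smul_pow, h, ← map_pow, matN_pow_eq_zero 2, map_zero, smul_zero]
  rw [expN, IsNilpotent.exp_eq_sum hz, Finset.sum_range_succ, Finset.sum_range_succ,
    Finset.sum_range_one, pow_zero, pow_one, smul_pow, h, ← map_pow, sq (matN 2)]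
  simp only [Nat.factorial_zero, Nat.factorial_one, Nat.factorial_two, Nat.cast_ofNat,
    Nat.cast_one, inv_one, one_smul, Matrix.add_apply, Matrix.smul_apply,
    RingHom.mapMatrix_apply, Matrix.map_apply, smul_eq_mul, Polynomial.C_mul]
  have h2 : ∀ P : ℂ[X], ((2 : ℚ)⁻¹) • P = Polynomial.C (2⁻¹ : ℂ) * P := fun P => by
    rw [← Polynomial.smul_eq_C_mul, ← Rat.cast_smul_eq_qsmul ℂ]
    norm_num
  have h1 : (1 : Matrix (Fin 2 × Fin 2) (Fin 2 × Fin 2) ℂ[X]) x y =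
      Polynomial.C ((1 : Matrix (Fin 2 × Fin 2) (Fin 2 × Fin 2) ℂ) x y) := by
    rw [Matrix.one_apply, Matrix.one_apply, apply_ite Polynomial.C, map_one, map_zero]
  have h3 := h2 (Polynomial.X ^ 2 * Polynomial.C ((matN 2 * matN 2) x y))
  rw [h1, h3]
  ring

theorem nablaPoly_two :
    nablaPoly (0 : Fin 2) 0 = 1 ∧ nablaPoly (1 : Fin 2) 0 = Polynomial.X ∧
      nablaPoly (0 : Fin 2) 1 = -Polynomial.X ∧ nablaPoly (1 : Fin 2) 1 = -Polynomial.X ^ 2 := by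
  have hhalf : (Polynomial.C 2⁻¹ * (-1 + -1) : ℂ[X]) = -1 := by
    rw [← Polynomial.C_1, ← Polynomial.C_neg, ← Polynomial.C_add, ← Polynomial.C_mul]
    norm_num
  refine ⟨?_, ?_, ?_, ?_⟩ <;> rw [nablaPoly, expN_two_apply] <;>
    simp [matN, blockA0, blockA, coeffA, Matrix.mul_apply, Fintype.sum_prod_type, Matrix.one_apply,
      hhalf]

theorem rTensor_jordan_two {τ : ℂ} (hτ : 0 < τ.im) {v₁ v₂ y₁ y₂ : ℂ}
    (hv : v₁ - v₂ ∉ lattice τ) (hy : y₂ - y₁ ∉ lattice τ) :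
    rTensor (jordan 2) τ v₁ v₂ y₁ y₂ =
        (Complex.exp (Real.pi * Complex.I * τ / 4) / (Complex.I * deriv (theta τ) 0)) •
          (sigma τ (v₁ - v₂) (y₂ - y₁) •
              (e 2 1 1 ⊗ₜ[ℂ] e 2 1 1 + e 2 2 2 ⊗ₜ[ℂ] e 2 2 2 +
                e 2 1 2 ⊗ₜ[ℂ] e 2 2 1 + e 2 2 1 ⊗ₜ[ℂ] e 2 1 2) +
            (-(1 / (2 * Real.pi * Complex.I)) *
                deriv (fun u => sigma τ u (y₂ - y₁)) (v₁ - v₂)) •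
              (e 2 1 2 ⊗ₜ[ℂ] (e 2 1 1 - e 2 2 2) - (e 2 1 1 - e 2 2 2) ⊗ₜ[ℂ] e 2 1 2) -
            ((-(1 / (2 * Real.pi * Complex.I))) ^ 2 *
                iteratedDeriv 2 (fun u => sigma τ u (y₂ - y₁)) (v₁ - v₂)) •
              (e 2 1 2 ⊗ₜ[ℂ] e 2 1 2)) := by
  obtain ⟨h00, h10, h01, h11⟩ := nablaPoly_two
  set f := fun u => sigma τ u (y₂ - y₁) with hf
  set c := -(1 / (2 * Real.pi * Complex.I)) with hc
  set w := v₁ - v₂ with hw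
  have o00 : nablaOp (0 : Fin 2) 0 f w = sigma τ w (y₂ - y₁) := by
    rw [nablaOp, h00, ← Polynomial.monomial_zero_one, polyNabla_monomial, one_mul]
    rfl
  have o10 : nablaOp (1 : Fin 2) 0 f w = c * deriv f w := by
    rw [nablaOp, h10, ← Polynomial.monomial_one_one_eq_X, polyNabla_monomial, one_mul]
    rfl
  have o01 : nablaOp (0 : Fin 2) 1 f w = -(c * deriv f w) := by
    rw [nablaOp, h01, ← Polynomial.monomial_one_one_eq_X, ← map_neg, polyNabla_monomial,
      neg_one_mul]
    rfl
  have o11 : nablaOp (1 : Fin 2) 1 f w = -(c ^ 2 * iteratedDeriv 2 f w) := by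
    rw [nablaOp, h11, ← Polynomial.monomial_one_right_eq_X_pow, ← map_neg, polyNabla_monomial,
      neg_one_mul, nabla_iterate_eq]
  have hI1 : Finset.Icc 1 (2 - ((0 : Fin 2) : ℕ)) = {1, 2} := by decide
  have hI2 : Finset.Icc 1 (2 - ((1 : Fin 2) : ℕ)) = {1} := by decide
  have he : ∀ i, e 2 i 3 = 0 ∧ e 2 3 i = 0 := fun i => by
    constructor <;> ext p q <;> rw [e_apply, if_neg (by omega)] <;> rfl
  rw [rTensor_jordan hτ 2 hv hy, Fin.sum_univ_two, Fin.sum_univ_two, Fin.sum_univ_two, o00, o10,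
    o01, o11, hI1, hI2]
  simp only [Finset.sum_pair (show (1 : ℕ) ≠ 2 by decide), Finset.sum_singleton, Fin.val_zero,
    Fin.val_one, add_zero, Nat.reduceAdd, TensorProduct.tmul_sub, TensorProduct.sub_tmul]
  congr 1
  -- The pair `(k,l) = (1,0)` contributes `e₁₂⊗e₁₁ + e₂₂⊗e₁₂`, and `(0,1)` contributes `e₁₁⊗e₁₂ +
  -- e₁₂⊗e₂₂` with the opposite sign; together they give `e₁₂⊗h - h⊗e₁₂`.
  module

end JordanAYBE

open JordanAYBE in
theorem mainTheorem5 (τ : ℂ) (hτ : 0 < τ.im) :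
    -- the denominators in the construction and in the formula do not vanish
    (deriv (theta τ) 0 ≠ 0 ∧
      ∀ z : ℂ, z ∉ lattice τ → theta τ z ≠ 0 ∧ thetaBar τ (z + (τ + 1) / 2) ≠ 0) ∧
    -- the general formula
    (∀ n : ℕ, 1 ≤ n →
      matN n ^ (2 * n - 1) = 0 ∧
      ∀ v₁ v₂ y₁ y₂ : ℂ, v₁ - v₂ ∉ lattice τ → y₂ - y₁ ∉ lattice τ →
        Function.Bijective (res (jordan n) τ (v₁ - v₂) y₁) ∧
        rTensor (jordan n) τ v₁ v₂ y₁ y₂ =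
          (Complex.exp (Real.pi * Complex.I * τ / 4) / (Complex.I * deriv (theta τ) 0)) •
            ∑ k : Fin n, ∑ l : Fin n,
              nablaOp k l (fun u => sigma τ u (y₂ - y₁)) (v₁ - v₂) •
                ∑ i ∈ Finset.Icc 1 (n - (l : ℕ)), ∑ j ∈ Finset.Icc 1 (n - (k : ℕ)),
                  e n i (j + (k : ℕ)) ⊗ₜ[ℂ] e n j (i + (l : ℕ))) ∧
    -- the case `n = 2`
    (∀ v₁ v₂ y₁ y₂ : ℂ, v₁ - v₂ ∉ lattice τ → y₂ - y₁ ∉ lattice τ →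
      rTensor (jordan 2) τ v₁ v₂ y₁ y₂ =
        (Complex.exp (Real.pi * Complex.I * τ / 4) / (Complex.I * deriv (theta τ) 0)) •
          (sigma τ (v₁ - v₂) (y₂ - y₁) •
              (e 2 1 1 ⊗ₜ[ℂ] e 2 1 1 + e 2 2 2 ⊗ₜ[ℂ] e 2 2 2 +
                e 2 1 2 ⊗ₜ[ℂ] e 2 2 1 + e 2 2 1 ⊗ₜ[ℂ] e 2 1 2) +
            (-(1 / (2 * Real.pi * Complex.I)) *
                deriv (fun u => sigma τ u (y₂ - y₁)) (v₁ - v₂)) •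
              (e 2 1 2 ⊗ₜ[ℂ] (e 2 1 1 - e 2 2 2) - (e 2 1 1 - e 2 2 2) ⊗ₜ[ℂ] e 2 1 2) -
            ((-(1 / (2 * Real.pi * Complex.I))) ^ 2 *
                iteratedDeriv 2 (fun u => sigma τ u (y₂ - y₁)) (v₁ - v₂)) •
              (e 2 1 2 ⊗ₜ[ℂ] e 2 1 2))) :=
  ⟨⟨deriv_theta_zero_ne_zero hτ, fun _ hz => ⟨theta_ne_zero hτ hz, thetaShift_ne_zero hτ hz⟩⟩,
    fun n _ => ⟨matN_pow_eq_zero n, fun _ _ y₁ _ hv hy =>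
      ⟨bijective_res_jordan hτ n y₁ hv, rTensor_jordan hτ n hv hy⟩⟩,
    fun _ _ _ _ hv hy => rTensor_jordan_two hτ hv hy⟩
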